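/- Let $\mathbb K=\mathbb R$ or $\mathbb C$ and use coordinates $(x,y,z,p,q)$ on $\mathbb K^5$. Let $\varpi=dz-p\,dx-q\,dy$ and let $\Upsilon$ be the symmetric $4$-tensor $$\Upsilon=81dp^4+216dp^3dx+216dp^2dq\,dy+144dp^2dx^2+24dp\,dq^3+288dp\,dq\,dx\,dy-384dp\,dy^3+32dq^3dx-48dq^2dy^2 .$$ **(a) Association with a solution of Noth's equation.** Consider the curve $$(t,H)=\Big(\frac{2s^{2/3}}{1+2s},-\frac{4s^{1/3}}{1+2s}\Big),\qquad s=r^3,\ s^{1/3}=r .$$ Near every $r_0\in\mathbb K$ with $r_0\ne0$, $r_0^3\neq1$, $1+2r_0^3\ne0$, this curve is the graph of a smooth function $H=H(t)$ with $H''\ne0$ which satisfies Noth's equation $$10H''^3H^{(6)}-70H''^2H'''H^{(5)}-49H''^2H''''^2+280H''H'''^2H''''-175H'''^4=0,$$ and, for a suitable choice of the constant of integration in $\int H\,dt$, the tensor $\Upsilon$ vanishes on the locus $\varpi=\omega_2=\omega_3=0$ (in particular on $\varpi=\omega_2=\omega_3=\omega_4=0$ with $\omega_4=dy-t\,dx$)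 for all values of the parameter near $r_0$, where $$\omega_2=dp+\big(t^2H'-2tH+2\textstyle\int H\,dt\big)dx+(H-tH')dy,\qquad \omega_3=dq+(H-tH')dx+H'dy .$$ **(b) Symmetry algebra.** Let $U\subseteq\mathbb K^5$ be any non-empty connected open set. Call a smooth (holomorphic if $\mathbb K=\mathbb C$) vector field $X$ on $U$ an infinitesimal symmetry of $[\varpi,\Upsilon]$ if $\mathcal L_X\varpi\equiv0\bmod\varpi$ and $\mathcal L_X\Upsilon\equiv 0\bmod \varpi,\Upsilon$. The infinitesimal symmetries on $U$ form a Lie algebra $\mathfrak g$ under the Lie bracket of vector fields, $\mathfrak g$ is isomorphic to the split Lie algebra $\mathfrak g_2$ over $\mathbb K$, and the restrictions to $U$ of the following $14$ vector fields form a basis of $\mathfrak g$: \begin{align*} S^1&=-(\tfrac{3}{16}q^2+\tfrac32xy+\tfrac98py)\partial_x-(\tfrac38pq+\tfrac12y^2+\tfrac12qx)\partial_y-(\tfrac9{16}p^2y+\tfrac14q^2x+\tfrac38q^2p+\tfrac32yz)\partial_z\\&\quad+\tfrac14q^2\partial_p+(-\tfrac32z+\tfrac32px-\tfrac12qy+\tfrac9{16}p^2)\partial_q,\\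 L^2&=-(\tfrac94px+\tfrac{27}{32}p^2-\tfrac34z+x^2+\tfrac34qy)\partial_x-(\tfrac34py+xy)\partial_y-(\tfrac98p^2x+\tfrac9{16}p^3+xz+\tfrac34pqy+\tfrac23y^3)\partial_z\\&\quad-(z-px-qy-\tfrac38p^2)\partial_p-2y^2\partial_q,\\ S^3&=-\tfrac38q\partial_x-(\tfrac38p+\tfrac12x)\partial_y-(\tfrac38pq+y^2)\partial_z+\tfrac12q\partial_p-2y\partial_q,\\ L^4&=-\tfrac34\partial_x+x\partial_z+\partial_p,\quad S^5=y\partial_z+\partial_q,\quad L^6=\partial_z,\quad S^7=\partial_y,\quad L^8=\partial_x,\\ S^9&=3y\partial_x+q\partial_y+\tfrac12q^2\partial_z-3p\partial_q,\\ L^{10}&=(3z+\tfrac{27}8p^2)\partial_x+\tfrac12q^2\partial_y+(\tfrac94p^3+\tfrac13q^3)\partial_z-3p^2\partial_p-3pq\partial_q,\\ S^{11}&=(-6y^2+\tfrac94qp)\partial_x+(3z+\tfrac98p^2-4qy)\partial_y+(\tfrac94p^2q-2yq^2)\partial_z-3pq\partial_p+(12py-q^2)\partial_q,\\ L^{12}&=-(3zx+\tfrac18q^3+\tfrac94pqy-2y^3+\tfrac{27}8p^2x+\tfrac{27}{16}p^3)\partial_x-(3yz+\tfrac12q^2x+\tfrac38pq^2-2qy^2+\tfrac98p^2y)\partial_y\\&\quad-(\tfrac94p^3x+\tfrac13xq^3+3z^2+\tfrac38q^3p-q^2y^2+\tfrac94qyp^2+\tfrac{81}{64}p^4)\partial_z\\&\quad+(-3pz+3p^2x+3pqy+\tfrac16q^3+\tfrac98p^3)\partial_p+(-3qz+3pqx+\tfrac98p^2q-6py^2+q^2y)\partial_q,\\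 h_1&=(\tfrac94p+\tfrac32x)\partial_x+\tfrac12y\partial_y+\tfrac98p^2\partial_z-\tfrac32p\partial_p-\tfrac12q\partial_q,\\ h_2&=\tfrac{\sqrt3}2(x\partial_x+y\partial_y+2z\partial_z+p\partial_p+q\partial_q). \end{align*} **(c) Root diagram.** $h_1,h_2$ span a Cartan subalgebra of $\mathfrak g$, and the other twelve fields are root vectors: $[h_1,V]=aV$ and $[h_2,V]=bV$, where the root $(a,b)$ is $$\begin{array}{llll} S^1:(\tfrac12,\tfrac{\sqrt3}2),&L^2:(\tfrac32,\tfrac{\sqrt3}2),&S^3:(1,0),&L^4:(\tfrac32,-\tfrac{\sqrt3}2),\\ S^5:(\tfrac12,-\tfrac{\sqrt3}2),&L^6:(0,-\sqrt3),&S^7:(-\tfrac12,-\tfrac{\sqrt3}2),&L^8:(-\tfrac32,-\tfrac{\sqrt3}2),\\ S^9:(-1,0),&L^{10}:(-\tfrac32,\tfrac{\sqrt3}2),&S^{11}:(-\tfrac12,\tfrac{\sqrt3}2),&L^{12}:(0,\sqrt3), \end{array}$$ that is, the $G_2$ root diagram in which the superscript is the hour on a clock face, with $S$ marking the short roots and $L$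 the long ones. -/

import Mathlib

open scoped Topology ContDiff

namespace NothContact

/-- The coordinate space `𝕜⁵` (`𝕜 = ℝ` or `ℂ`), with coordinates `(x, y, z, p, q)` in this order. The
tangent space at each point is identified with `𝕜⁵` by the frame `∂x, ∂y, ∂z, ∂p, ∂q`. -/
abbrev Coord (𝕜 : Type*) : Type _ := Fin 5 → 𝕜

section VectorFields

variable {𝕜 : Type*} [RCLike 𝕜]

/-- The smooth vector fields on an open set `U` of `𝕜⁵` (holomorphic ones if `𝕜 = ℂ`). A vector field
on `U` is represented by its extension by zero to all of `𝕜⁵`, so that two vector fields on `U` are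
equal exactly when they agree at every point of `U`. -/
def smoothVF (U : TopologicalSpace.Opens (Coord 𝕜)) : Submodule 𝕜 (Coord 𝕜 → Coord 𝕜) where
  carrier := {X | ContDiffOn 𝕜 ∞ X U ∧ ∀ u ∉ U, X u = 0}
  add_mem' := by
    rintro X Y ⟨hX, hX'⟩ ⟨hY, hY'⟩
    exact ⟨hX.add hY, fun u hu => by simp [hX' u hu, hY' u hu]⟩
  zero_mem' := ⟨contDiffOn_const, fun _ _ => rfl⟩
  smul_mem' := by
    rintro c X ⟨hX, hX'⟩
    exact ⟨hX.const_smul c, fun u hu => by simp [hX' u hu]⟩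

variable {U : TopologicalSpace.Opens (Coord 𝕜)}

theorem smoothVF_contDiffAt (X : smoothVF U) {u : Coord 𝕜} (hu : u ∈ U) :
    ContDiffAt 𝕜 ∞ (X : Coord 𝕜 → Coord 𝕜) u :=
  X.2.1.contDiffAt (U.isOpen.mem_nhds hu)

theorem smoothVF_differentiableAt (X : smoothVF U) {u : Coord 𝕜} (hu : u ∈ U) :
    DifferentiableAt 𝕜 (X : Coord 𝕜 → Coord 𝕜) u :=
  (smoothVF_contDiffAt X hu).differentiableAt (by simp)

theorem smoothVF_ext {X Y : smoothVF U}
    (h : ∀ u ∈ U, (X : Coord 𝕜 → Coord 𝕜) u = (Y : Coord 𝕜 → Coord 𝕜) u) : X = Y := by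
  apply Subtype.ext
  funext u
  by_cases hu : u ∈ U
  · exact h u hu
  · rw [X.2.2 u hu, Y.2.2 u hu]

open Classical in
/-- The Lie bracket `[X, Y] = DY(X) - DX(Y)` of vector fields on `U`. -/
noncomputable instance : Bracket (smoothVF U) (smoothVF U) where
  bracket X Y := ⟨fun u => if u ∈ U then VectorField.lieBracket 𝕜 X Y u else 0, by
    constructor
    · have h : ContDiffOn 𝕜 ∞ (VectorField.lieBracket 𝕜 (X : Coord 𝕜 → Coord 𝕜) Y) U :=
        fun u hu => ((smoothVF_contDiffAt X hu).lieBracket_vectorField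
          (smoothVF_contDiffAt Y hu) (by simp)).contDiffWithinAt
      refine h.congr fun u hu => ?_
      exact if_pos hu
    · intro u hu
      exact if_neg hu⟩

theorem smoothVF_bracket_apply (X Y : smoothVF U) {u : Coord 𝕜} (hu : u ∈ U) :
    (⁅X, Y⁆ : smoothVF U).1 u = VectorField.lieBracket 𝕜 X.1 Y.1 u :=
  if_pos hu

theorem smoothVF_bracket_eventuallyEq (X Y : smoothVF U) {u : Coord 𝕜} (hu : u ∈ U) :
    (⁅X, Y⁆ : smoothVF U).1 =ᶠ[𝓝 u] VectorField.lieBracket 𝕜 X.1 Y.1 := by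
  filter_upwards [U.isOpen.mem_nhds hu] with w hw
  exact smoothVF_bracket_apply X Y hw

noncomputable instance : LieRing (smoothVF U) where
  add_lie X Y Z := smoothVF_ext fun u hu => by
    change _ = (⁅X, Z⁆ : smoothVF U).1 u + (⁅Y, Z⁆ : smoothVF U).1 u
    simp only [smoothVF_bracket_apply _ _ hu]
    exact VectorField.lieBracket_add_left (smoothVF_differentiableAt X hu)
      (smoothVF_differentiableAt Y hu)
  lie_add X Y Z := smoothVF_ext fun u hu => by
    change _ = (⁅X, Y⁆ : smoothVF U).1 u + (⁅X, Z⁆ : smoothVF U).1 u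
    simp only [smoothVF_bracket_apply _ _ hu]
    exact VectorField.lieBracket_add_right (smoothVF_differentiableAt Y hu)
      (smoothVF_differentiableAt Z hu)
  lie_self X := smoothVF_ext fun u hu => by
    rw [smoothVF_bracket_apply _ _ hu]
    simp
  leibniz_lie X Y Z := smoothVF_ext fun u hu => by
    change _ = (⁅⁅X, Y⁆, Z⁆ : smoothVF U).1 u + (⁅Y, ⁅X, Z⁆⁆ : smoothVF U).1 u
    simp only [smoothVF_bracket_apply _ _ hu]
    rw [(Filter.EventuallyEq.refl _ X.1).lieBracket_vectorField_eq
        (smoothVF_bracket_eventuallyEq Y Z hu),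
      (smoothVF_bracket_eventuallyEq X Y hu).lieBracket_vectorField_eq
        (Filter.EventuallyEq.refl _ Z.1),
      (Filter.EventuallyEq.refl _ Y.1).lieBracket_vectorField_eq
        (smoothVF_bracket_eventuallyEq X Z hu)]
    exact VectorField.leibniz_identity_lieBracket (n := ∞)
      (by
        rw [minSmoothness_of_isRCLikeNormedField]
        exact WithTop.coe_le_coe.2 (le_top (a := (2 : ℕ∞))))
      (smoothVF_contDiffAt X hu) (smoothVF_contDiffAt Y hu) (smoothVF_contDiffAt Z hu)

noncomputable instance : LieAlgebra 𝕜 (smoothVF U) where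
  lie_smul c X Y := smoothVF_ext fun u hu => by
    change _ = c • (⁅X, Y⁆ : smoothVF U).1 u
    simp only [smoothVF_bracket_apply _ _ hu]
    exact VectorField.lieBracket_const_smul_right (smoothVF_differentiableAt Y hu)

end VectorFields

section Structure

variable {𝕜 : Type*} [RCLike 𝕜]

/-- The contact form `ϖ = dz - p dx - q dy`, at the point `u`, on the tangent vector `v`. -/
def contactForm (u v : Coord 𝕜) : 𝕜 := v 2 - u 3 * v 0 - u 4 * v 1

/-- The structural tensor `Υ`, a symmetric `4`-tensor field, as the quartic form that it defines on
each tangent space; `dx, dy, dp, dq` are the components `v 0, v 1, v 3, v 4`. Its coefficients do not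
depend on the point `u`. -/
def structuralTensor (_u v : Coord 𝕜) : 𝕜 :=
  let dx := v 0
  let dy := v 1
  let dp := v 3
  let dq := v 4
  81 * dp ^ 4 + 216 * dp ^ 3 * dx + 216 * dp ^ 2 * dq * dy + 144 * dp ^ 2 * dx ^ 2
    + 24 * dp * dq ^ 3 + 288 * dp * dq * dx * dy - 384 * dp * dy ^ 3 + 32 * dq ^ 3 * dx
    - 48 * dq ^ 2 * dy ^ 2

/-- The Lie derivative `L_X T` of a symmetric covariant tensor field `T` of degree `k`, where `T` and
`L_X T` are regarded as functions of a point `u` and a tangent vector `v` that are homogeneous of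
degree `k` in `v` (`T u v = T_u(v, …, v)`). It is the derivative of `T` along the flow on the tangent
bundle that is induced by `X`, whose velocity at `(u, v)` is `(X u, DX_u v)`; in terms of the
`k`-linear form, `(L_X T)_u(v, …, v) = (∂_X T)_u(v, …, v) + k T_u(DX_u v, v, …, v)`. -/
noncomputable def lieDeriv (X : Coord 𝕜 → Coord 𝕜) (T : Coord 𝕜 → Coord 𝕜 → 𝕜)
    (u v : Coord 𝕜) : 𝕜 :=
  fderiv 𝕜 (fun w : Coord 𝕜 × Coord 𝕜 => T w.1 w.2) (u, v) (X u, fderiv 𝕜 X u v)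

/-- `X` is an infinitesimal symmetry on `U` of the structure `[ϖ, Υ]`: `L_X ϖ ≡ 0` modulo `ϖ`, and
`L_X Υ ≡ 0` modulo `ϖ, Υ`. A quartic form is divisible by the non-zero linear form `ϖ_u` exactly when
it vanishes on the contact hyperplane `ϖ_u = 0`. -/
def IsSymmetry (U : TopologicalSpace.Opens (Coord 𝕜)) (X : Coord 𝕜 → Coord 𝕜) : Prop :=
  (∀ u ∈ U, ∃ f : 𝕜, ∀ v, lieDeriv X contactForm u v = f * contactForm u v) ∧
  (∀ u ∈ U, ∃ g : 𝕜, ∀ v, contactForm u v = 0 →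
    lieDeriv X structuralTensor u v = g * structuralTensor u v)

end Structure

section Fields

variable (𝕜 : Type*) [RCLike 𝕜]

/-- The root vectors `S¹, L², S³, L⁴, S⁵, L⁶, S⁷, L⁸, S⁹, L¹⁰, S¹¹, L¹²`, in this order: the index
`k : Fin 12` stands for the hour `k + 1` of the clock face. -/
def rootField (k : Fin 12) (u : Coord 𝕜) : Coord 𝕜 :=
  let x := u 0
  let y := u 1
  let z := u 2
  let p := u 3
  let q := u 4
  (![
    ![-(3 / 16 * q ^ 2 + 3 / 2 * x * y + 9 / 8 * p * y),
      -(3 / 8 * p * q + 1 / 2 * y ^ 2 + 1 / 2 * q * x),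
      -(9 / 16 * p ^ 2 * y + 1 / 4 * q ^ 2 * x + 3 / 8 * q ^ 2 * p + 3 / 2 * y * z),
      1 / 4 * q ^ 2,
      -3 / 2 * z + 3 / 2 * p * x - 1 / 2 * q * y + 9 / 16 * p ^ 2],
    ![-(9 / 4 * p * x + 27 / 32 * p ^ 2 - 3 / 4 * z + x ^ 2 + 3 / 4 * q * y),
      -(3 / 4 * p * y + x * y),
      -(9 / 8 * p ^ 2 * x + 9 / 16 * p ^ 3 + x * z + 3 / 4 * p * q * y + 2 / 3 * y ^ 3),
      -(z - p * x - q * y - 3 / 8 * p ^ 2),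
      -2 * y ^ 2],
    ![-3 / 8 * q, -(3 / 8 * p + 1 / 2 * x), -(3 / 8 * p * q + y ^ 2), 1 / 2 * q, -2 * y],
    ![-3 / 4, 0, x, 1, 0],
    ![0, 0, y, 0, 1],
    ![0, 0, 1, 0, 0],
    ![0, 1, 0, 0, 0],
    ![1, 0, 0, 0, 0],
    ![3 * y, q, 1 / 2 * q ^ 2, 0, -3 * p],
    ![3 * z + 27 / 8 * p ^ 2, 1 / 2 * q ^ 2, 9 / 4 * p ^ 3 + 1 / 3 * q ^ 3, -3 * p ^ 2,
      -3 * p * q],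
    ![-6 * y ^ 2 + 9 / 4 * q * p,
      3 * z + 9 / 8 * p ^ 2 - 4 * q * y,
      9 / 4 * p ^ 2 * q - 2 * y * q ^ 2,
      -3 * p * q,
      12 * p * y - q ^ 2],
    ![-(3 * z * x + 1 / 8 * q ^ 3 + 9 / 4 * p * q * y - 2 * y ^ 3 + 27 / 8 * p ^ 2 * x
        + 27 / 16 * p ^ 3),
      -(3 * y * z + 1 / 2 * q ^ 2 * x + 3 / 8 * p * q ^ 2 - 2 * q * y ^ 2 + 9 / 8 * p ^ 2 * y),
      -(9 / 4 * p ^ 3 * x + 1 / 3 * x * q ^ 3 + 3 * z ^ 2 + 3 / 8 * q ^ 3 * p - q ^ 2 * y ^ 2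
        + 9 / 4 * q * y * p ^ 2 + 81 / 64 * p ^ 4),
      -3 * p * z + 3 * p ^ 2 * x + 3 * p * q * y + 1 / 6 * q ^ 3 + 9 / 8 * p ^ 3,
      -3 * q * z + 3 * p * q * x + 9 / 8 * p ^ 2 * q - 6 * p * y ^ 2 + q ^ 2 * y]
    ] : Fin 12 → Coord 𝕜) k

/-- The number `√3 / 2` in `𝕜`. -/
noncomputable def halfSqrtThree : 𝕜 := ((Real.sqrt 3 / 2 : ℝ) : 𝕜)

/-- The vector fields `h₁, h₂`. -/
noncomputable def cartanField (j : Fin 2) (u : Coord 𝕜) : Coord 𝕜 :=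
  let x := u 0
  let y := u 1
  let z := u 2
  let p := u 3
  let q := u 4
  (![
    ![9 / 4 * p + 3 / 2 * x, 1 / 2 * y, 9 / 8 * p ^ 2, -3 / 2 * p, -1 / 2 * q],
    halfSqrtThree 𝕜 • ![x, y, 2 * z, p, q]
    ] : Fin 2 → Coord 𝕜) j

/-- The fourteen vector fields: the twelve root vectors and `h₁, h₂`. -/
noncomputable def g2Field : Fin 12 ⊕ Fin 2 → Coord 𝕜 → Coord 𝕜 :=
  Sum.elim (rootField 𝕜) (cartanField 𝕜)

/-- The root diagram of type `G₂` on a clock face: `rootDiagram k` is the position in the plane of the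
root at the hour `k + 1`. Odd hours are the short roots, of length `1`, and even hours the long roots,
of length `√3`. -/
noncomputable def rootDiagram (k : Fin 12) : Fin 2 → 𝕜 :=
  let s := halfSqrtThree 𝕜
  (![![1 / 2, s], ![3 / 2, s], ![1, 0], ![3 / 2, -s], ![1 / 2, -s], ![0, -(2 * s)],
    ![-(1 / 2), -s], ![-(3 / 2), -s], ![-1, 0], ![-(3 / 2), s], ![-(1 / 2), s], ![0, 2 * s]] :
    Fin 12 → Fin 2 → 𝕜) k

end Fields

section Noth

variable {𝕜 : Type*} [RCLike 𝕜]

/-- `H` satisfies Noth's equation at `t`. -/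
def NothAt (H : 𝕜 → 𝕜) (t : 𝕜) : Prop :=
  let D := fun n : ℕ => iteratedDeriv n H t
  10 * D 2 ^ 3 * D 6 - 70 * D 2 ^ 2 * D 3 * D 5 - 49 * D 2 ^ 2 * D 4 ^ 2
    + 280 * D 2 * D 3 ^ 2 * D 4 - 175 * D 3 ^ 4 = 0

/-- `t = 2 s^(2/3) / (1 + 2 s)` with `s = r³`. -/
def curveT (r : 𝕜) : 𝕜 := 2 * r ^ 2 / (1 + 2 * r ^ 3)

/-- `H = -4 s^(1/3) / (1 + 2 s)` with `s = r³`. -/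
def curveH (r : 𝕜) : 𝕜 := -4 * r / (1 + 2 * r ^ 3)

/-- The structural form `ω₂ = dp + (t² H' - 2 t H + 2 ∫ H dt) dx + (H - t H') dy` of a function `H` at
the parameter value `t`, where `G` is the chosen antiderivative `∫ H dt` of `H`. -/
noncomputable def omegaTwo (H G : 𝕜 → 𝕜) (t : 𝕜) (v : Coord 𝕜) : 𝕜 :=
  v 3 + (t ^ 2 * deriv H t - 2 * t * H t + 2 * G t) * v 0 + (H t - t * deriv H t) * v 1

/-- The structural form `ω₃ = dq + (H - t H') dx + H' dy`. -/
noncomputable def omegaThree (H : 𝕜 → 𝕜) (t : 𝕜) (v : Coord 𝕜) : 𝕜 :=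
  v 4 + (H t - t * deriv H t) * v 0 + deriv H t * v 1

/-- `[ϖ, Υ]` is associated to the solution of Noth's equation that is parametrized by
`(t, H) = (2 s^(2/3) / (1 + 2 s), -4 s^(1/3) / (1 + 2 s))`, `s = r³`: near each parameter value with
`r ≠ 0`, `r³ ≠ 1`, `1 + 2 r³ ≠ 0` the curve is the graph of a smooth function `H` of `t`, which solves
Noth's equation with `H'' ≠ 0`, and for a suitable antiderivative `G` of `H` the tensor `Υ` vanishes on
the locus `ϖ = ω₂ = ω₃ = 0` for every value of the parameter (and so on its subset `ω₄ = dy - t dx = 0`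
too). -/
def AssociatedToNothCurve (𝕜 : Type*) [RCLike 𝕜] : Prop :=
  ∀ r₀ : 𝕜, r₀ ≠ 0 → r₀ ^ 3 ≠ 1 → 1 + 2 * r₀ ^ 3 ≠ 0 →
    ∃ H G : 𝕜 → 𝕜, ∀ᶠ r in 𝓝 r₀,
      H (curveT r) = curveH r ∧ ContDiffAt 𝕜 ∞ H (curveT r) ∧
      HasDerivAt G (H (curveT r)) (curveT r) ∧
      iteratedDeriv 2 H (curveT r) ≠ 0 ∧ NothAt H (curveT r) ∧
      ∀ u v : Coord 𝕜, contactForm u v = 0 → omegaTwo H G (curveT r) v = 0 →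
        omegaThree H (curveT r) v = 0 → structuralTensor u v = 0

end Noth

end NothContact

/-! In the frame `E₁, …, E₄` of the contact distribution the `dp⁴`, `dp³dx` and similar mixed terms
of `Υ` cancel. For a contact vector `∑ aᵢEᵢ` what remains is `16(9a₁²a₄² + 18a₁a₂a₃a₄ + 2a₂³a₄ -
24a₁a₃³ - 3a₂²a₃²)`, which is, up to constant factors, the discriminant of the binary cubic `AX³ +
3BX²Y + 3CXY² + DY³` with `(A, B, C, D) = (-6a₁, a₂, a₃, a₄/2)`. Its linear symmetries are `gl₂`
acting on cubics, and the structure is the flat one with the contact grading `1 + 4 + 4 + 4 + 1` of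
`𝔤₂`.

Upper bound: a symmetry is determined by its generating function `f = ϖ(X)`. Invariance of `Υ` is a
system of seven linear second-order equations for `f` (`hessian_of_mem_symmetrySubmodule`), because
`sl₂` has codimension `7` in `sp₄`. Prolonging it shows that `f` is fixed by fourteen derivatives at
one point (`eq_zero_of_jet_eq_zero`). The fourteen given fields are independent symmetries, so they
span (`span_g2VF`).

Identification: `LieAlgebra.g₂` is the algebra presented by the Serre relations. The simple root
vectors `S³`, `L¹⁰` and multiples of `S⁹`, `L⁴` satisfy these relations, which gives a homomorphism
from `𝔤₂` whose range contains all fourteen fields. Conversely fourteen words span the presented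
algebra (`span_serreWords`), so counting dimensions makes the homomorphism injective with range
exactly the symmetries. In particular they are closed under the bracket. The root diagram is a
computation of weights.

Part (a): on the curve the derivatives of `H` in `t` are explicit rational functions of `r`, so
Noth's equation is a polynomial identity. The locus `ϖ = ω₂ = ω₃ = 0` consists of the cubics
divisible by `(2X + rY)²`, on which the discriminant vanishes. -/

namespace NothContact

/-! ### Spanning words for the Serre relations of type `G₂` -/

section SerreWords

variable {R L : Type*} [Field R] [LieRing L] [LieAlgebra R L]

/-- The brackets with the generators of the positive root vectors `[a, b]`, `[a, [a, b]]`, … of a Lie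
algebra with generators that satisfy the Serre relations of type `G₂`. -/
theorem serre_g2_brackets (R : Type*) [Field R] [CharZero R] [LieAlgebra R L]
    {a b f g h k : L}
    (haf : ⁅f, a⁆ = -h) (hbg : ⁅g, b⁆ = -k) (hbf : ⁅f, b⁆ = 0) (hag : ⁅g, a⁆ = 0)
    (hha : ⁅h, a⁆ = (2 : R) • a) (hhb : ⁅h, b⁆ = (-3 : R) • b)
    (hka : ⁅k, a⁆ = (-1 : R) • a) (hkb : ⁅k, b⁆ = (2 : R) • b)
    (ha : ⁅a, ⁅a, ⁅a, ⁅a, b⁆⁆⁆⁆ = 0) (hb : ⁅b, ⁅a, b⁆⁆ = 0) :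
    ⁅b, ⁅a, ⁅a, b⁆⁆⁆ = 0 ∧ ⁅a, ⁅b, ⁅a, ⁅a, ⁅a, b⁆⁆⁆⁆⁆ = 0 ∧ ⁅b, ⁅b, ⁅a, ⁅a, ⁅a, b⁆⁆⁆⁆⁆ = 0 ∧
    ⁅f, ⁅a, b⁆⁆ = (3 : R) • b ∧ ⁅f, ⁅a, ⁅a, b⁆⁆⁆ = (4 : R) • ⁅a, b⁆ ∧
    ⁅f, ⁅a, ⁅a, ⁅a, b⁆⁆⁆⁆ = (3 : R) • ⁅a, ⁅a, b⁆⁆ ∧ ⁅f, ⁅b, ⁅a, ⁅a, ⁅a, b⁆⁆⁆⁆⁆ = 0 ∧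
    ⁅g, ⁅a, b⁆⁆ = (-1 : R) • a ∧ ⁅g, ⁅a, ⁅a, b⁆⁆⁆ = 0 ∧ ⁅g, ⁅a, ⁅a, ⁅a, b⁆⁆⁆⁆ = 0 ∧
    ⁅g, ⁅b, ⁅a, ⁅a, ⁅a, b⁆⁆⁆⁆⁆ = ⁅a, ⁅a, ⁅a, b⁆⁆⁆ := by
  have swap : ∀ x y : L, ⁅x, y⁆ = -⁅y, x⁆ := fun x y => (lie_skew x y).symm
  set x1 := ⁅a, b⁆ with hx1
  set x2 := ⁅a, x1⁆ with hx2
  set x3 := ⁅a, x2⁆ with hx3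
  set x4 := ⁅b, x3⁆ with hx4
  have hba : ⁅b, a⁆ = -x1 := swap _ _
  have b2 : ⁅b, x2⁆ = 0 := by rw [hx2, leibniz_lie, hba, hb]; simp
  have h4 : x4 = -⁅x1, x2⁆ := by rw [hx4, hx3, leibniz_lie, hba, b2]; simp
  -- Expanding `x4` as `⁅b, x3⁆` and as `-⁅x1, x2⁆` gives the same bracket with opposite signs, so
  -- twice it is zero.
  have a4 : ⁅a, x4⁆ = 0 := by
    have e1 : ⁅a, x4⁆ = ⁅x1, x3⁆ := by rw [hx4, leibniz_lie, ha, ← hx1]; simp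
    have e2 : ⁅a, x4⁆ = -⁅x1, x3⁆ := by
      rw [h4, lie_neg, leibniz_lie, ← hx2, ← hx3]; simp
    have e3 : (2 : R) • ⁅a, x4⁆ = 0 := by
      rw [two_smul]; nth_rewrite 2 [e2]; rw [e1, add_neg_cancel]
    exact (smul_eq_zero.1 e3).resolve_left two_ne_zero
  have b4 : ⁅b, x4⁆ = 0 := by rw [h4, lie_neg, leibniz_lie, hb, b2]; simp
  have h1 : ⁅h, x1⁆ = (-1 : R) • x1 := by
    rw [hx1, leibniz_lie, hha, hhb, smul_lie, lie_smul]; module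
  have h2 : ⁅h, x2⁆ = (1 : R) • x2 := by
    rw [hx2, leibniz_lie, hha, h1, smul_lie, lie_smul]; module
  have k1 : ⁅k, x1⁆ = (1 : R) • x1 := by
    rw [hx1, leibniz_lie, hka, hkb, smul_lie, lie_smul]; module
  have k2 : ⁅k, x2⁆ = 0 := by
    rw [hx2, leibniz_lie, hka, k1, smul_lie, lie_smul]; module
  have k3 : ⁅k, x3⁆ = (-1 : R) • x3 := by
    rw [hx3, leibniz_lie, hka, k2, smul_lie]; simp
  have f1 : ⁅f, x1⁆ = (3 : R) • b := by
    rw [hx1, leibniz_lie, haf, hbf, neg_lie, hhb]; simp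
  have f2 : ⁅f, x2⁆ = (4 : R) • x1 := by
    rw [hx2, leibniz_lie, haf, f1, neg_lie, h1, lie_smul, ← hx1]; module
  have f3 : ⁅f, x3⁆ = (3 : R) • x2 := by
    rw [hx3, leibniz_lie, haf, f2, neg_lie, h2, lie_smul, ← hx2]; module
  have f4 : ⁅f, x4⁆ = 0 := by
    rw [hx4, leibniz_lie, hbf, f3, lie_smul, b2]; simp
  have g1 : ⁅g, x1⁆ = (-1 : R) • a := by
    rw [hx1, leibniz_lie, hag, hbg, lie_neg, lie_skew, hka]; simp
  have g2 : ⁅g, x2⁆ = 0 := by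
    rw [hx2, leibniz_lie, hag, g1, lie_smul]; simp
  have g3 : ⁅g, x3⁆ = 0 := by
    rw [hx3, leibniz_lie, hag, g2]; simp
  have g4 : ⁅g, x4⁆ = x3 := by
    rw [hx4, leibniz_lie, hbg, g3, neg_lie, k3]; simp
  exact ⟨b2, a4, b4, f1, f2, f3, f4, g1, g2, g3, g4⟩

/-- A submodule that is stable under the bracket with each element of a generating set is stable under
the bracket with every element of the Lie subalgebra generated. -/
theorem lie_mem_of_mem_lieSpan {s : Set L} {S : Submodule R L} (hs : ∀ x ∈ s, ∀ y ∈ S, ⁅x, y⁆ ∈ S)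
    {x : L} (hx : x ∈ LieSubalgebra.lieSpan R L s) {y : L} (hy : y ∈ S) : ⁅x, y⁆ ∈ S := by
  let T : LieSubalgebra R L :=
    { carrier := {x | ∀ y ∈ S, ⁅x, y⁆ ∈ S}
      add_mem' := fun hx hx' y hy => by
        rw [add_lie]; exact S.add_mem (hx y hy) (hx' y hy)
      zero_mem' := fun y _ => by simp
      smul_mem' := fun c x hx y hy => by
        rw [smul_lie]; exact S.smul_mem c (hx y hy)
      lie_mem' := fun {x x'} hx hx' y hy => by
        rw [lie_lie]; exact S.sub_mem (hx _ (hx' y hy)) (hx' _ (hx y hy)) }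
  have : LieSubalgebra.lieSpan R L s ≤ T := LieSubalgebra.lieSpan_le.2 fun x hx => hs x hx
  exact this hx y hy

/-- The fourteen elements of a Lie algebra with generators `a, b, f, g` that span it when the Serre
relations of type `G₂` hold. -/
def serreWords (a b f g h k : L) : Fin 14 → L :=
  ![h, k, a, b, ⁅a, b⁆, ⁅a, ⁅a, b⁆⁆, ⁅a, ⁅a, ⁅a, b⁆⁆⁆, ⁅b, ⁅a, ⁅a, ⁅a, b⁆⁆⁆⁆,
    f, g, ⁅f, g⁆, ⁅f, ⁅f, g⁆⁆, ⁅f, ⁅f, ⁅f, g⁆⁆⁆, ⁅g, ⁅f, ⁅f, ⁅f, g⁆⁆⁆⁆]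

/-- The words are `h, k` and one vector for each of the twelve roots. Their span is stable under the
bracket with `a, b, f, g`, hence under the algebra that these generate, so it is a subalgebra
containing the generators. -/
theorem span_serreWords [CharZero R] {a b f g h k : L}
    (haf : ⁅a, f⁆ = h) (hbg : ⁅b, g⁆ = k) (hbf : ⁅b, f⁆ = 0) (hag : ⁅a, g⁆ = 0)
    (hha : ⁅h, a⁆ = (2 : R) • a) (hhb : ⁅h, b⁆ = (-3 : R) • b)
    (hka : ⁅k, a⁆ = (-1 : R) • a) (hkb : ⁅k, b⁆ = (2 : R) • b)
    (hhf : ⁅h, f⁆ = (-2 : R) • f) (hhg : ⁅h, g⁆ = (3 : R) • g)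
    (hkf : ⁅k, f⁆ = (1 : R) • f) (hkg : ⁅k, g⁆ = (-2 : R) • g)
    (ha : ⁅a, ⁅a, ⁅a, ⁅a, b⁆⁆⁆⁆ = 0) (hb : ⁅b, ⁅a, b⁆⁆ = 0)
    (hf : ⁅f, ⁅f, ⁅f, ⁅f, g⁆⁆⁆⁆ = 0) (hg : ⁅g, ⁅f, g⁆⁆ = 0)
    (hgen : LieSubalgebra.lieSpan R L {a, b, f, g} = ⊤) :
    Submodule.span R (Set.range (serreWords a b f g h k)) = ⊤ := by
  have swap : ∀ x y : L, ⁅x, y⁆ = -⁅y, x⁆ := fun x y => (lie_skew x y).symm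
  obtain ⟨p1, p2, p3, p4, p5, p6, p7, p8, p9, p10, p11⟩ := serre_g2_brackets R
    (a := a) (b := b) (f := f) (g := g) (h := h) (k := k) (by rw [swap, haf]) (by rw [swap, hbg])
    (by rw [swap, hbf, neg_zero]) (by rw [swap, hag, neg_zero]) hha hhb hka hkb ha hb
  -- The relations are invariant under exchanging `a, b` with `f, g` and changing the sign of `h,
  -- k`, so the negative root vectors need no separate computation.
  obtain ⟨n1, n2, n3, n4, n5, n6, n7, n8, n9, n10, n11⟩ := serre_g2_brackets R
    (a := f) (b := g) (f := a) (g := b) (h := -h) (k := -k) (by rw [haf, neg_neg])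
    (by rw [hbg, neg_neg]) hag hbf (by rw [neg_lie, hhf]; module) (by rw [neg_lie, hhg]; module)
    (by rw [neg_lie, hkf]; module) (by rw [neg_lie, hkg]; module) hf hg
  have hah : ⁅a, h⁆ = (-2 : R) • a := by rw [swap, hha]; module
  have hbh : ⁅b, h⁆ = (3 : R) • b := by rw [swap, hhb]; module
  have hak : ⁅a, k⁆ = (1 : R) • a := by rw [swap, hka]; module
  have hbk : ⁅b, k⁆ = (-2 : R) • b := by rw [swap, hkb]; module
  have hfh : ⁅f, h⁆ = (2 : R) • f := by rw [swap, hhf]; module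
  have hgh : ⁅g, h⁆ = (-3 : R) • g := by rw [swap, hhg]; module
  have hfk : ⁅f, k⁆ = (-1 : R) • f := by rw [swap, hkf]; module
  have hgk : ⁅g, k⁆ = (2 : R) • g := by rw [swap, hkg]; module
  have hba : ⁅b, a⁆ = (-1 : R) • ⁅a, b⁆ := by rw [swap]; module
  have hgf : ⁅g, f⁆ = (-1 : R) • ⁅f, g⁆ := by rw [swap]; module
  have hfa : ⁅f, a⁆ = (-1 : R) • h := by rw [swap, haf]; module
  have hgb : ⁅g, b⁆ = (-1 : R) • k := by rw [swap, hbg]; module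
  have hfb : ⁅f, b⁆ = 0 := by rw [swap, hbf, neg_zero]
  have hga : ⁅g, a⁆ = 0 := by rw [swap, hag, neg_zero]
  set S := Submodule.span R (Set.range (serreWords a b f g h k)) with hS
  have mem : ∀ i, serreWords a b f g h k i ∈ S := fun i => Submodule.subset_span ⟨i, rfl⟩
  have m0 : h ∈ S := mem 0
  have m1 : k ∈ S := mem 1
  have m2 : a ∈ S := mem 2
  have m3 : b ∈ S := mem 3
  have m4 : ⁅a, b⁆ ∈ S := mem 4
  have m5 : ⁅a, ⁅a, b⁆⁆ ∈ S := mem 5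
  have m6 : ⁅a, ⁅a, ⁅a, b⁆⁆⁆ ∈ S := mem 6
  have m7 : ⁅b, ⁅a, ⁅a, ⁅a, b⁆⁆⁆⁆ ∈ S := mem 7
  have m8 : f ∈ S := mem 8
  have m9 : g ∈ S := mem 9
  have m10 : ⁅f, g⁆ ∈ S := mem 10
  have m11 : ⁅f, ⁅f, g⁆⁆ ∈ S := mem 11
  have m12 : ⁅f, ⁅f, ⁅f, g⁆⁆⁆ ∈ S := mem 12
  have m13 : ⁅g, ⁅f, ⁅f, ⁅f, g⁆⁆⁆⁆ ∈ S := mem 13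
  have stable : ∀ x ∈ ({a, b, f, g} : Set L), ∀ y ∈ S, ⁅x, y⁆ ∈ S := by
    intro x hx y hy
    have key : ∀ i, ⁅x, serreWords a b f g h k i⁆ ∈ S := by
      have hx' : x = a ∨ x = b ∨ x = f ∨ x = g := hx
      intro i
      rcases hx' with rfl | rfl | rfl | rfl <;> fin_cases i <;>
        simp only [serreWords, Fin.reduceFinMk, Matrix.cons_val, Fin.zero_eta, Fin.mk_one, Fin.isValue,
          hah, hbh, hak, hbk, hfh, hgh, hfk, hgk, hba, hgf, hfa, hgb, hfb, hga, haf, hbg, hbf, hag,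
          ha, hb, hf, hg, p1, p2, p3, p4, p5, p6, p7, p8, p9, p10, p11, n1, n2, n3, n4, n5, n6, n7,
          n8, n9, n10, n11, lie_self] <;>
        first
          | exact S.zero_mem
          | assumption
          | (apply S.smul_mem; assumption)
    induction hy using Submodule.span_induction with
    | mem y hy => obtain ⟨i, rfl⟩ := hy; exact key i
    | zero => simp
    | add y z _ _ hy hz => rw [lie_add]; exact S.add_mem hy hz
    | smul c y _ hy => rw [lie_smul]; exact S.smul_mem c hy
  have ideal : ∀ x y : L, y ∈ S → ⁅x, y⁆ ∈ S := fun x y hy =>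
    lie_mem_of_mem_lieSpan stable (by rw [hgen]; trivial) hy
  let T : LieSubalgebra R L := { S with lie_mem' := fun {x y} _ hy => ideal x y hy }
  have hT : LieSubalgebra.lieSpan R L {a, b, f, g} ≤ T := by
    rw [LieSubalgebra.lieSpan_le]
    rintro x (rfl | rfl | rfl | rfl)
    exacts [m2, m3, m8, m9]
  rw [eq_top_iff]
  intro x _
  have hx : x ∈ LieSubalgebra.lieSpan R L {a, b, f, g} := by rw [hgen]; trivial
  exact hT hx

end SerreWords

/-! ### The presented algebra `𝔤₂`: universal property and bound on the dimension -/

section SerreAlgebra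

/-- The homomorphism induced on a quotient Lie algebra. -/
def lieQuotientLift {R L L' : Type*} [CommRing R] [LieRing L] [LieAlgebra R L] [LieRing L']
    [LieAlgebra R L'] (I : LieIdeal R L) (φ : L →ₗ⁅R⁆ L') (hI : I ≤ φ.ker) : L ⧸ I →ₗ⁅R⁆ L' where
  toLinearMap := I.toSubmodule.liftQ (φ : L →ₗ[R] L') fun x hx => by
    simpa using hI hx
  map_lie' {x y} := by
    obtain ⟨x, rfl⟩ := LieSubmodule.Quotient.surjective_mk' I x
    obtain ⟨y, rfl⟩ := LieSubmodule.Quotient.surjective_mk' I y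
    exact φ.map_lie x y

/-- The projection on a quotient Lie algebra, as a homomorphism of Lie algebras. -/
def lieQuotientMk {R L : Type*} [CommRing R] [LieRing L] [LieAlgebra R L] (I : LieIdeal R L) :
    L →ₗ⁅R⁆ L ⧸ I where
  toLinearMap := (LieSubmodule.Quotient.mk' I : L →ₗ[R] L ⧸ I)
  map_lie' {x y} := LieSubmodule.Quotient.mk_bracket I x y

theorem lieQuotientMk_eq_zero {R L : Type*} [CommRing R] [LieRing L] [LieAlgebra R L]
    (I : LieIdeal R L) {x : L} (hx : x ∈ I) : lieQuotientMk I x = 0 :=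
  (LieSubmodule.Quotient.mk_eq_zero (N := I)).2 hx

variable (R : Type*) [Field R] [CharZero R]

-- Applied to the projection onto `LieAlgebra.g₂`, this bounds its dimension by `14`. In Mathlib's
-- matrix `G₂` index `0` is the short simple root, so `ad (E 0)` has the long string.
open CartanMatrix in
theorem span_serreWords_of_surjective {L : Type*} [LieRing L] [LieAlgebra R L]
    (π : FreeLieAlgebra R (Generators (Fin 2)) →ₗ⁅R⁆ L) (hsurj : Function.Surjective π)
    (rel : ∀ x ∈ Relations.toSet R G₂, π x = 0) :
    Submodule.span R (Set.range (serreWords (π (.of R (.E 0))) (π (.of R (.E 1)))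
      (π (.of R (.F 0))) (π (.of R (.F 1))) (π (.of R (.H 0))) (π (.of R (.H 1))))) = ⊤ := by
  have hEF : ∀ i j, π (Relations.EF R (i, j)) = 0 := fun i j =>
    rel _ (Or.inl (Or.inl (Or.inl (Or.inl (Or.inr ⟨(i, j), rfl⟩)))))
  have hHE : ∀ i j, π (Relations.HE R G₂ (i, j)) = 0 := fun i j =>
    rel _ (Or.inl (Or.inl (Or.inl (Or.inr ⟨(i, j), rfl⟩))))
  have hHF : ∀ i j, π (Relations.HF R G₂ (i, j)) = 0 := fun i j =>
    rel _ (Or.inl (Or.inl (Or.inr ⟨(i, j), rfl⟩)))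
  have hE : ∀ i j, π (Relations.adE R G₂ (i, j)) = 0 := fun i j =>
    rel _ (Or.inl (Or.inr ⟨(i, j), rfl⟩))
  have hF : ∀ i j, π (Relations.adF R G₂ (i, j)) = 0 := fun i j => rel _ (Or.inr ⟨(i, j), rfl⟩)
  have toInt : ∀ (n : ℤ) (x : FreeLieAlgebra R (Generators (Fin 2))), n • x = (n : R) • x :=
    fun n x => (Int.cast_smul_eq_zsmul R n x).symm
  have e00 : ⁅π (.of R (.E 0)), π (.of R (.F 0))⁆ = π (.of R (.H 0)) := by
    have := hEF 0 0
    simpa [Relations.EF, sub_eq_zero] using this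
  have e11 : ⁅π (.of R (.E 1)), π (.of R (.F 1))⁆ = π (.of R (.H 1)) := by
    have := hEF 1 1
    simpa [Relations.EF, sub_eq_zero] using this
  refine span_serreWords e00 e11 ?_ ?_ ?_ ?_ ?_ ?_ ?_ ?_ ?_ ?_ ?_ ?_ ?_ ?_ ?_
  · have := hEF 1 0
    simpa [Relations.EF] using this
  · have := hEF 0 1
    simpa [Relations.EF] using this
  · have := hHE 0 0
    simpa [Relations.HE, G₂, toInt, sub_eq_zero] using this
  · have := hHE 0 1
    simpa [Relations.HE, G₂, toInt, add_eq_zero_iff_eq_neg] using this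
  · have := hHE 1 0
    simpa [Relations.HE, G₂, toInt, add_eq_zero_iff_eq_neg] using this
  · have := hHE 1 1
    simpa [Relations.HE, G₂, toInt, sub_eq_zero] using this
  · have := hHF 0 0
    simpa [Relations.HF, G₂, toInt, add_eq_zero_iff_eq_neg] using this
  · have := hHF 0 1
    simpa [Relations.HF, G₂, toInt, add_neg_eq_zero] using this
  · have := hHF 1 0
    simpa [Relations.HF, G₂, toInt, add_neg_eq_zero] using this
  · have := hHF 1 1
    simpa [Relations.HF, G₂, toInt, add_eq_zero_iff_eq_neg] using this
  · have := hE 0 1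
    simpa [Relations.adE, G₂, pow_succ] using this
  · have := hE 1 0
    rw [← lie_skew (π (.of R (.E 0))), lie_neg, neg_eq_zero]
    simpa [Relations.adE, G₂] using this
  · have := hF 0 1
    simpa [Relations.adF, G₂, pow_succ] using this
  · have := hF 1 0
    rw [← lie_skew (π (.of R (.F 0))), lie_neg, neg_eq_zero]
    simpa [Relations.adF, G₂] using this
  -- The generators `H` are brackets of `E` and `F`, so `K` contains the image of every generator.
  -- Hence `π` factors through `K`, and surjectivity gives `K = ⊤`.
  · set K := LieSubalgebra.lieSpan R L {π (.of R (.E 0)), π (.of R (.E 1)),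
      π (.of R (.F 0)), π (.of R (.F 1))} with hK
    have gE0 : π (.of R (.E 0)) ∈ K := LieSubalgebra.subset_lieSpan (by simp)
    have gE1 : π (.of R (.E 1)) ∈ K := LieSubalgebra.subset_lieSpan (by simp)
    have gF0 : π (.of R (.F 0)) ∈ K := LieSubalgebra.subset_lieSpan (by simp)
    have gF1 : π (.of R (.F 1)) ∈ K := LieSubalgebra.subset_lieSpan (by simp)
    have gH0 : π (.of R (.H 0)) ∈ K := by rw [← e00]; exact K.lie_mem gE0 gF0
    have gH1 : π (.of R (.H 1)) ∈ K := by rw [← e11]; exact K.lie_mem gE1 gF1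
    have gen : ∀ x, π (.of R x) ∈ K := by
      rintro (i | i | i) <;> fin_cases i
      exacts [gH0, gH1, gE0, gE1, gF0, gF1]
    let ψ : FreeLieAlgebra R (Generators (Fin 2)) →ₗ⁅R⁆ K :=
      FreeLieAlgebra.lift R fun x => ⟨π (.of R x), gen x⟩
    have hψ : K.incl.comp ψ = π := by
      apply FreeLieAlgebra.hom_ext
      intro x
      simp [ψ]
    rw [eq_top_iff]
    intro x _
    obtain ⟨x, rfl⟩ := hsurj x
    rw [← hψ]
    exact (ψ x).2

open CartanMatrix in
/-- The homomorphism from the split Lie algebra `𝔤₂` that is given by elements of a Lie algebra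
which satisfy the Serre relations. -/
theorem exists_g2_hom {L : Type*} [LieRing L] [LieAlgebra R L] {a b f g h k : L}
    (hhk : ⁅h, k⁆ = 0)
    (haf : ⁅a, f⁆ = h) (hbg : ⁅b, g⁆ = k) (hbf : ⁅b, f⁆ = 0) (hag : ⁅a, g⁆ = 0)
    (hha : ⁅h, a⁆ = (2 : R) • a) (hhb : ⁅h, b⁆ = (-3 : R) • b)
    (hka : ⁅k, a⁆ = (-1 : R) • a) (hkb : ⁅k, b⁆ = (2 : R) • b)
    (hhf : ⁅h, f⁆ = (-2 : R) • f) (hhg : ⁅h, g⁆ = (3 : R) • g)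
    (hkf : ⁅k, f⁆ = (1 : R) • f) (hkg : ⁅k, g⁆ = (-2 : R) • g)
    (ha : ⁅a, ⁅a, ⁅a, ⁅a, b⁆⁆⁆⁆ = 0) (hb : ⁅b, ⁅a, b⁆⁆ = 0)
    (hf : ⁅f, ⁅f, ⁅f, ⁅f, g⁆⁆⁆⁆ = 0) (hg : ⁅g, ⁅f, g⁆⁆ = 0) :
    ∃ (φ : LieAlgebra.g₂ R →ₗ⁅R⁆ L) (w : Fin 14 → LieAlgebra.g₂ R),
      Submodule.span R (Set.range w) = ⊤ ∧ ∀ i, φ (w i) = serreWords a b f g h k i := by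
  let gen : Generators (Fin 2) → L
    | .H i => ![h, k] i
    | .E i => ![a, b] i
    | .F i => ![f, g] i
  have swap : ∀ x y : L, ⁅x, y⁆ = -⁅y, x⁆ := fun x y => (lie_skew x y).symm
  have toInt : ∀ (n : ℤ) (x : L), n • x = (n : R) • x :=
    fun n x => (Int.cast_smul_eq_zsmul R n x).symm
  let ψ := FreeLieAlgebra.lift R gen
  have hψ : ∀ x, ψ (FreeLieAlgebra.of R x) = gen x := fun x => FreeLieAlgebra.lift_of_apply gen x
  have hba : ⁅b, ⁅b, a⁆⁆ = 0 := by rw [swap b a, lie_neg, hb, neg_zero]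
  have hgf : ⁅g, ⁅g, f⁆⁆ = 0 := by rw [swap g f, lie_neg, hg, neg_zero]
  have hI : Relations.toIdeal R G₂ ≤ ψ.ker := by
    refine LieSubmodule.lieSpan_le.2 ?_
    rintro x (((((⟨⟨i, j⟩, rfl⟩ | ⟨⟨i, j⟩, rfl⟩) | ⟨⟨i, j⟩, rfl⟩) | ⟨⟨i, j⟩, rfl⟩) | ⟨⟨i, j⟩, rfl⟩) |
      ⟨⟨i, j⟩, rfl⟩) <;> fin_cases i <;> fin_cases j <;>
      simp [LieHom.mem_ker, Relations.HH, Relations.EF, Relations.HE, Relations.HF, Relations.adE,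
        Relations.adF, G₂, hψ, gen, pow_succ, hhk, swap k h, haf, hbg, hbf, hag, hha, hhb, hka, hkb,
        hhf, hhg, hkf, hkg, ha, hba, hf, hgf, toInt]
  let φ : LieAlgebra.g₂ R →ₗ⁅R⁆ L := lieQuotientLift _ ψ hI
  let π : FreeLieAlgebra R (Generators (Fin 2)) →ₗ⁅R⁆ LieAlgebra.g₂ R :=
    lieQuotientMk (Relations.toIdeal R G₂)
  have hφ : ∀ x, φ (π (FreeLieAlgebra.of R x)) = gen x := hψ
  have hspan := span_serreWords_of_surjective R π (LieSubmodule.Quotient.surjective_mk' _)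
    fun x hx => lieQuotientMk_eq_zero _ (LieSubmodule.subset_lieSpan hx)
  refine ⟨φ, _, hspan, fun i => ?_⟩
  fin_cases i <;> simp [serreWords, hφ, gen]

end SerreAlgebra

/-! ### Differentials and linear independence of the fourteen fields -/

section Jacobians

variable (𝕜 : Type*) [RCLike 𝕜]

/-- The differential of `rootField 𝕜 k` at the point `u`, applied to the vector `v`. -/
def rootJac (k : Fin 12) (u v : Coord 𝕜) : Coord 𝕜 :=
  let x := u 0
  let y := u 1
  let z := u 2
  let p := u 3
  let q := u 4
  (![
    ![-3 / 2 * y * v 0 + (-3 / 2 * x - 9 / 8 * p) * v 1 - 9 / 8 * y * v 3 - 3 / 8 * q * v 4,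
      -1 / 2 * q * v 0 - y * v 1 - 3 / 8 * q * v 3 + (-1 / 2 * x - 3 / 8 * p) * v 4,
      -1 / 4 * q ^ 2 * v 0 + (-3 / 2 * z - 9 / 16 * p ^ 2) * v 1 - 3 / 2 * y * v 2
        + (-9 / 8 * y * p - 3 / 8 * q ^ 2) * v 3 + (-1 / 2 * x * q - 3 / 4 * p * q) * v 4,
      1 / 2 * q * v 4,
      3 / 2 * p * v 0 - 1 / 2 * q * v 1 - 3 / 2 * v 2 + (3 / 2 * x + 9 / 8 * p) * v 3
        - 1 / 2 * y * v 4],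
    ![(-2 * x - 9 / 4 * p) * v 0 - 3 / 4 * q * v 1 + 3 / 4 * v 2 + (-9 / 4 * x
        - 27 / 16 * p) * v 3 - 3 / 4 * y * v 4,
      -y * v 0 + (-x - 3 / 4 * p) * v 1 - 3 / 4 * y * v 3,
      (-z - 9 / 8 * p ^ 2) * v 0 + (-2 * y ^ 2 - 3 / 4 * p * q) * v 1 - x * v 2
        + (-9 / 4 * x * p - 3 / 4 * y * q - 27 / 16 * p ^ 2) * v 3 - 3 / 4 * y * p * v 4,
      p * v 0 + q * v 1 - v 2 + (x + 3 / 4 * p) * v 3 + y * v 4, -4 * y * v 1],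
    ![-3 / 8 * v 4, -1 / 2 * v 0 - 3 / 8 * v 3, -2 * y * v 1 - 3 / 8 * q * v 3 - 3 / 8 * p * v 4,
      1 / 2 * v 4, -2 * v 1],
    ![0, 0, v 0, 0, 0],
    ![0, 0, v 1, 0, 0],
    ![0, 0, 0, 0, 0],
    ![0, 0, 0, 0, 0],
    ![0, 0, 0, 0, 0],
    ![3 * v 1, v 4, q * v 4, 0, -3 * v 3],
    ![3 * v 2 + 27 / 4 * p * v 3, q * v 4, 27 / 4 * p ^ 2 * v 3 + q ^ 2 * v 4, -6 * p * v 3,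
      -3 * q * v 3 - 3 * p * v 4],
    ![-12 * y * v 1 + 9 / 4 * q * v 3 + 9 / 4 * p * v 4,
      -4 * q * v 1 + 3 * v 2 + 9 / 4 * p * v 3 - 4 * y * v 4,
      -2 * q ^ 2 * v 1 + 9 / 2 * p * q * v 3 + (-4 * y * q + 9 / 4 * p ^ 2) * v 4,
      -3 * q * v 3 - 3 * p * v 4, 12 * p * v 1 + 12 * y * v 3 - 2 * q * v 4],
    ![(-3 * z - 27 / 8 * p ^ 2) * v 0 + (6 * y ^ 2 - 9 / 4 * p * q) * v 1 - 3 * x * v 2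
        + (-27 / 4 * x * p - 9 / 4 * y * q - 81 / 16 * p ^ 2) * v 3 + (-9 / 4 * y * p
        - 3 / 8 * q ^ 2) * v 4,
      -1 / 2 * q ^ 2 * v 0 + (4 * y * q - 3 * z - 9 / 8 * p ^ 2) * v 1 - 3 * y * v 2
        + (-9 / 4 * y * p - 3 / 8 * q ^ 2) * v 3 + (-x * q + 2 * y ^ 2 - 3 / 4 * p * q) * v 4,
      (-9 / 4 * p ^ 3 - 1 / 3 * q ^ 3) * v 0 + (2 * y * q ^ 2 - 9 / 4 * p ^ 2 * q) * v 1
        - 6 * z * v 2 + (-27 / 4 * x * p ^ 2 - 9 / 2 * y * p * q - 81 / 16 * p ^ 3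
        - 3 / 8 * q ^ 3) * v 3 + (-x * q ^ 2 + 2 * y ^ 2 * q - 9 / 4 * y * p ^ 2
        - 9 / 8 * p * q ^ 2) * v 4,
      3 * p ^ 2 * v 0 + 3 * p * q * v 1 - 3 * p * v 2 + (6 * x * p + 3 * y * q - 3 * z
        + 27 / 8 * p ^ 2) * v 3 + (3 * y * p + 1 / 2 * q ^ 2) * v 4,
      3 * p * q * v 0 + (-12 * y * p + q ^ 2) * v 1 - 3 * q * v 2 + (3 * x * q - 6 * y ^ 2
        + 9 / 4 * p * q) * v 3 + (3 * x * p + 2 * y * q - 3 * z + 9 / 8 * p ^ 2) * v 4]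
    ] : Fin 12 → Coord 𝕜) k

/-- The differential of `cartanField 𝕜 j` at the point `u`, applied to the vector `v`. -/
noncomputable def cartanJac (j : Fin 2) (u v : Coord 𝕜) : Coord 𝕜 :=
  (![
    ![3 / 2 * v 0 + 9 / 4 * v 3, 1 / 2 * v 1, 9 / 4 * u 3 * v 3, -3 / 2 * v 3, -1 / 2 * v 4],
    halfSqrtThree 𝕜 • ![v 0, v 1, 2 * v 2, v 3, v 4]
    ] : Fin 2 → Coord 𝕜) j

/-- The differential of `g2Field 𝕜 i` at the point `u`, applied to the vector `v`. -/
noncomputable def g2Jac : Fin 12 ⊕ Fin 2 → Coord 𝕜 → Coord 𝕜 → Coord 𝕜 :=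
  Sum.elim (rootJac 𝕜) (cartanJac 𝕜)

theorem hasFDerivAt_coord (i : Fin 5) (u : Coord 𝕜) :
    HasFDerivAt (fun w : Coord 𝕜 => w i) (ContinuousLinearMap.proj (R := 𝕜) i) u :=
  hasFDerivAt_apply i u

theorem contDiff_g2Field (i : Fin 12 ⊕ Fin 2) : ContDiff 𝕜 ω (g2Field 𝕜 i) := by
  rw [contDiff_pi]
  intro k
  rcases i with i | i <;> fin_cases i <;> fin_cases k <;>
    simp only [g2Field, rootField, cartanField, Sum.elim_inl, Sum.elim_inr, Fin.zero_eta, Fin.mk_one,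
      Fin.reduceFinMk, Fin.isValue, Matrix.cons_val, Pi.smul_apply, smul_eq_mul] <;>
    fun_prop

theorem differentiable_g2Field (i : Fin 12 ⊕ Fin 2) : Differentiable 𝕜 (g2Field 𝕜 i) :=
  (contDiff_g2Field 𝕜 i).differentiable (by simp)

variable {𝕜} in
theorem fderiv_apply_coord {X : Coord 𝕜 → Coord 𝕜} {u : Coord 𝕜} (hX : DifferentiableAt 𝕜 X u)
    (k : Fin 5) (v : Coord 𝕜) : fderiv 𝕜 (fun w => X w k) u v = fderiv 𝕜 X u v k := by
  have h := (hasFDerivAt_pi'.1 hX.hasFDerivAt k).fderiv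
  rw [h]
  rfl

-- Once the differentials are known as explicit polynomials, every bracket and Lie derivative of the
-- fields is a polynomial identity.
set_option maxHeartbeats 2000000 in
theorem fderiv_rootField_coord (i : Fin 12) (k : Fin 5) (u v : Coord 𝕜) :
    fderiv 𝕜 (fun w => rootField 𝕜 i w k) u v = rootJac 𝕜 i u v k := by
  have hc : ∀ j, fderiv 𝕜 (fun w : Coord 𝕜 => w j) u = ContinuousLinearMap.proj (R := 𝕜) j :=
    fun j => (hasFDerivAt_coord 𝕜 j u).fderiv
  fin_cases i <;> fin_cases k <;>
    simp (disch := fun_prop) only [rootField, rootJac, Fin.zero_eta, Fin.mk_one, Fin.reduceFinMk,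
      Fin.isValue, Matrix.cons_val, hc, fderiv_fun_add, fderiv_fun_sub, fderiv_fun_neg, fderiv_fun_mul,
      fderiv_fun_pow, fderiv_const_apply, add_apply, sub_apply, smul_apply, neg_apply, zero_apply,
      ContinuousLinearMap.proj_apply, smul_eq_mul, nsmul_eq_mul, Nat.cast_ofNat, Nat.add_one_sub_one] <;>
    ring

theorem fderiv_cartanField_coord (i : Fin 2) (k : Fin 5) (u v : Coord 𝕜) :
    fderiv 𝕜 (fun w => cartanField 𝕜 i w k) u v = cartanJac 𝕜 i u v k := by
  have hc : ∀ j, fderiv 𝕜 (fun w : Coord 𝕜 => w j) u = ContinuousLinearMap.proj (R := 𝕜) j :=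
    fun j => (hasFDerivAt_coord 𝕜 j u).fderiv
  fin_cases i <;> fin_cases k <;>
    simp (disch := fun_prop) only [cartanField, cartanJac, Fin.zero_eta, Fin.mk_one, Fin.reduceFinMk,
      Fin.isValue, Matrix.cons_val, hc, fderiv_fun_add, fderiv_fun_mul,
      fderiv_fun_pow, fderiv_const_apply, add_apply, smul_apply, zero_apply,
      ContinuousLinearMap.proj_apply, smul_eq_mul, nsmul_eq_mul, Nat.cast_ofNat,
      Nat.add_one_sub_one, Pi.smul_apply] <;>
    ring

theorem fderiv_g2Field (i : Fin 12 ⊕ Fin 2) (u v : Coord 𝕜) :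
    fderiv 𝕜 (g2Field 𝕜 i) u v = g2Jac 𝕜 i u v := by
  ext k
  rw [← fderiv_apply_coord (differentiable_g2Field 𝕜 i u) k v]
  rcases i with i | i
  · exact fderiv_rootField_coord 𝕜 i k u v
  · exact fderiv_cartanField_coord 𝕜 i k u v

theorem halfSqrtThree_ne_zero : halfSqrtThree 𝕜 ≠ 0 := by
  rw [halfSqrtThree, Ne, RCLike.ofReal_eq_zero]
  positivity

/-- The fourteen vector fields are linearly independent on every non-empty open set. -/
theorem g2Field_coeff_eq_zero {U : TopologicalSpace.Opens (Coord 𝕜)} (hU : (U : Set (Coord 𝕜)).Nonempty)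
    (c : Fin 12 ⊕ Fin 2 → 𝕜) (h : ∀ u ∈ U, ∑ i, c i • g2Field 𝕜 i u = 0) : c = 0 := by
  obtain ⟨u₀, hu₀⟩ := hU
  -- By analytic continuation the relation holds on all of `𝕜⁵`, so it can be evaluated at
  -- convenient points outside `U`.
  have han : AnalyticOnNhd 𝕜 (fun u => ∑ i, c i • g2Field 𝕜 i u) Set.univ := fun u _ =>
    (ContDiff.sum fun i _ => (contDiff_g2Field 𝕜 i).const_smul (c i)).contDiffAt.analyticAt
  have hall : (fun u => ∑ i, c i • g2Field 𝕜 i u) = fun _ => 0 :=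
    han.eq_of_eventuallyEq (fun u _ => analyticAt_const) (z₀ := u₀)
      (Filter.eventuallyEq_of_mem (U.isOpen.mem_nhds hu₀) fun u hu => h u hu)
  have ev : ∀ (u : Coord 𝕜) (k : Fin 5), ∑ i, c i * g2Field 𝕜 i u k = 0 := fun u k => by
    have := congrFun (congrFun hall u) k
    simpa using this
  -- The origin and the unit points of the `x`, `y`, `z` axes already give enough equations to
  -- isolate all fourteen coefficients.
  have e00 := ev ![0, 0, 0, 0, 0] 0
  have e01 := ev ![0, 0, 0, 0, 0] 1
  have e02 := ev ![0, 0, 0, 0, 0] 2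
  have e03 := ev ![0, 0, 0, 0, 0] 3
  have e04 := ev ![0, 0, 0, 0, 0] 4
  have e10 := ev ![1, 0, 0, 0, 0] 0
  have e11 := ev ![1, 0, 0, 0, 0] 1
  have e12 := ev ![1, 0, 0, 0, 0] 2
  have e13 := ev ![1, 0, 0, 0, 0] 3
  have e14 := ev ![1, 0, 0, 0, 0] 4
  have e20 := ev ![0, 1, 0, 0, 0] 0
  have e21 := ev ![0, 1, 0, 0, 0] 1
  have e22 := ev ![0, 1, 0, 0, 0] 2
  have e23 := ev ![0, 1, 0, 0, 0] 3
  have e24 := ev ![0, 1, 0, 0, 0] 4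
  have e30 := ev ![0, 0, 1, 0, 0] 0
  have e31 := ev ![0, 0, 1, 0, 0] 1
  have e32 := ev ![0, 0, 1, 0, 0] 2
  have e33 := ev ![0, 0, 1, 0, 0] 3
  have e34 := ev ![0, 0, 1, 0, 0] 4
  simp [Fintype.sum_sum_type, Fin.sum_univ_succ, g2Field, rootField, cartanField] at e00 e01 e02 e03 e04 e10 e11 e12 e13 e14 e20 e21 e22 e23 e24 e30 e31 e32 e33 e34
  have i0 : c (Sum.inl 0) = 0 := by
    linear_combination 2 / 3 * e04 - 2 / 3 * e34
  have i1 : c (Sum.inl 1) = 0 := by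
    linear_combination -3 * e01 + 3 / 2 * e02 + 3 / 2 * e04 + 3 * e11 - 3 / 2 * e22
  have i2 : c (Sum.inl 2) = 0 := by
    linear_combination 2 * e01 - 2 * e11
  have i3 : c (Sum.inl 3) = 0 := by
    linear_combination e03
  have i4 : c (Sum.inl 4) = 0 := by
    linear_combination e04
  have i5 : c (Sum.inl 5) = 0 := by
    linear_combination e02
  have i6 : c (Sum.inl 6) = 0 := by
    linear_combination e01
  have i7 : c (Sum.inl 7) = 0 := by
    linear_combination e00 + 3 / 4 * e03
  have i8 : c (Sum.inl 8) = 0 := by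
    linear_combination -5 / 9 * e00 - 2 / 3 * e01 + 1 / 9 * e02 + 1 / 9 * e04 + 2 / 9 * e10 + 2 / 3 * e11 + 1 / 3 * e20 - 2 / 3 * e21 - 1 / 3 * e22 + 2 / 3 * e31 + 2 / 9 * e32 + 2 / 9 * e34
  have i9 : c (Sum.inl 9) = 0 := by
    linear_combination -1 / 3 * e00 + 3 / 4 * e01 - 3 / 8 * e02 - 3 / 8 * e04 - 3 / 4 * e11 + 3 / 8 * e22 + 1 / 3 * e30
  have i10 : c (Sum.inl 10) = 0 := by
    linear_combination -1 / 3 * e01 + 1 / 3 * e31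
  have i11 : c (Sum.inl 11) = 0 := by
    linear_combination 1 / 3 * e00 - 1 / 6 * e02 - 1 / 6 * e04 - 1 / 3 * e10 - e11 + e21 + 1 / 2 * e22 - 1 / 3 * e32 - 1 / 3 * e34
  have i12 : c (Sum.inr 0) = 0 := by
    linear_combination -e00 - 2 * e01 + 3 / 2 * e02 + 7 / 6 * e04 + e10 + 3 * e11 - e21 - 3 / 2 * e22 + 1 / 3 * e34
  have i13 : c (Sum.inr 1) * halfSqrtThree 𝕜 = 0 := by
    linear_combination 1 / 2 * e00 - 3 / 4 * e02 - 1 / 4 * e04 - 1 / 2 * e10 - 3 / 2 * e11 + 3 / 2 * e21 + 3 / 4 * e22 - 1 / 2 * e34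
  have i14 : c (Sum.inr 1) = 0 := (mul_eq_zero.1 i13).resolve_right (halfSqrtThree_ne_zero 𝕜)
  funext i
  rcases i with i | i <;> fin_cases i <;> assumption

end Jacobians

/-! ### Brackets of the fourteen fields -/

section Brackets

variable {𝕜 : Type*} [RCLike 𝕜] {U : TopologicalSpace.Opens (Coord 𝕜)}

variable (U) in
open Classical in
/-- The restrictions to `U` of the fourteen vector fields. -/
noncomputable def g2VF (i : Fin 12 ⊕ Fin 2) : smoothVF U :=
  ⟨fun u => if u ∈ U then g2Field 𝕜 i u else 0,
    ((contDiff_g2Field 𝕜 i).of_le (by simp)).contDiffOn.congr fun _ hu => if_pos hu,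
    fun _ hu => if_neg hu⟩

theorem g2VF_apply (i : Fin 12 ⊕ Fin 2) {u : Coord 𝕜} (hu : u ∈ U) :
    (g2VF U i).1 u = g2Field 𝕜 i u :=
  if_pos hu

theorem g2VF_eventuallyEq (i : Fin 12 ⊕ Fin 2) {u : Coord 𝕜} (hu : u ∈ U) :
    (g2VF U i).1 =ᶠ[𝓝 u] g2Field 𝕜 i := by
  filter_upwards [U.isOpen.mem_nhds hu] with w hw
  exact g2VF_apply i hw

theorem fderiv_g2VF (i : Fin 12 ⊕ Fin 2) {u : Coord 𝕜} (hu : u ∈ U) (v : Coord 𝕜) :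
    fderiv 𝕜 (g2VF U i).1 u v = g2Jac 𝕜 i u v := by
  rw [(g2VF_eventuallyEq i hu).fderiv_eq, fderiv_g2Field]

theorem linearIndependent_g2VF (hU : (U : Set (Coord 𝕜)).Nonempty) :
    LinearIndependent 𝕜 (g2VF U) := by
  rw [Fintype.linearIndependent_iff]
  intro c hc
  refine congrFun (g2Field_coeff_eq_zero 𝕜 hU c fun u hu => ?_)
  have h := congrFun (congrArg Subtype.val hc) u
  simpa [g2VF_apply _ hu] using h

/-- Two terms on the right are needed because `⁅L¹⁰, L⁴⁆` involves both `h₁` and `h₂`. For the other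
brackets one coefficient is zero and the second index is a placeholder. -/
theorem bracket_g2VF {i j k l : Fin 12 ⊕ Fin 2} (a b : 𝕜)
    (h : ∀ u n, g2Jac 𝕜 j u (g2Field 𝕜 i u) n - g2Jac 𝕜 i u (g2Field 𝕜 j u) n =
      a * g2Field 𝕜 k u n + b * g2Field 𝕜 l u n) :
    ⁅g2VF U i, g2VF U j⁆ = a • g2VF U k + b • g2VF U l := by
  refine smoothVF_ext fun u hu => ?_
  rw [smoothVF_bracket_apply _ _ hu, VectorField.lieBracket_eq]
  funext n
  simp only [Submodule.coe_add, Submodule.coe_smul, Pi.add_apply, Pi.sub_apply, Pi.smul_apply,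
    smul_eq_mul]
  have hi := g2VF_apply i hu
  have hj := g2VF_apply j hu
  have hk := g2VF_apply k hu
  have hl := g2VF_apply l hu
  rw [hi, hj, hk, hl, fderiv_g2VF i hu, fderiv_g2VF j hu, h]

theorem bracket_rootVF {i j k : Fin 12} (a : 𝕜)
    (h : ∀ u n, rootJac 𝕜 j u (rootField 𝕜 i u) n - rootJac 𝕜 i u (rootField 𝕜 j u) n =
      a * rootField 𝕜 k u n) :
    ⁅g2VF U (.inl i), g2VF U (.inl j)⁆ = a • g2VF U (.inl k) := by
  rw [bracket_g2VF (k := .inl k) (l := .inl k) a 0 fun u n => by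
    rw [zero_mul, add_zero]; exact h u n]
  module

theorem bracket_cartanVF : ⁅g2VF U (.inr 0), g2VF U (.inr 1)⁆ = 0 := by
  rw [bracket_g2VF (k := .inr 0) (l := .inr 0) 0 0 fun u n => ?_]
  · module
  · fin_cases n <;> simp [g2Jac, g2Field, cartanField, cartanJac] <;> ring

set_option maxHeartbeats 2000000 in
theorem bracket_cartanVF_rootVF (j : Fin 2) (k : Fin 12) :
    ⁅g2VF U (.inr j), g2VF U (.inl k)⁆ = rootDiagram 𝕜 k j • g2VF U (.inl k) := by
  rw [bracket_g2VF (k := .inl k) (l := .inl k) (rootDiagram 𝕜 k j) 0 fun u n => ?_]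
  · module
  · fin_cases j <;> fin_cases k <;> fin_cases n <;>
      simp only [g2Jac, g2Field, cartanField, cartanJac, rootField, rootJac, rootDiagram, Sum.elim_inl,
        Sum.elim_inr, Fin.zero_eta, Fin.mk_one, Fin.reduceFinMk, Fin.isValue, Matrix.cons_val,
        Pi.smul_apply, smul_eq_mul] <;>
      ring

/-- First step of the root string `L¹⁰, S¹¹, S¹, L²` in the direction of `S³`. That it stops at `L²`
is the long Serre relation. -/
theorem bracket_S3_L10 : ⁅g2VF U (.inl 2), g2VF U (.inl 9)⁆ = (1 / 2 : 𝕜) • g2VF U (.inl 10) := by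
  rw [bracket_rootVF (k := 10) (1 / 2) fun u n => ?_]
  fin_cases n <;> simp only [rootField, rootJac, Fin.zero_eta, Fin.mk_one, Fin.reduceFinMk,
      Fin.isValue, Matrix.cons_val] <;> ring

theorem bracket_S3_S11 : ⁅g2VF U (.inl 2), g2VF U (.inl 10)⁆ = (-4 : 𝕜) • g2VF U (.inl 0) := by
  rw [bracket_rootVF (k := 0) (-4) fun u n => ?_]
  fin_cases n <;> simp only [rootField, rootJac, Fin.zero_eta, Fin.mk_one, Fin.reduceFinMk,
      Fin.isValue, Matrix.cons_val] <;> ring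

theorem bracket_S3_S1 : ⁅g2VF U (.inl 2), g2VF U (.inl 0)⁆ = (-3 / 4 : 𝕜) • g2VF U (.inl 1) := by
  rw [bracket_rootVF (k := 1) (-3 / 4) fun u n => ?_]
  fin_cases n <;> simp only [rootField, rootJac, Fin.zero_eta, Fin.mk_one, Fin.reduceFinMk,
      Fin.isValue, Matrix.cons_val] <;> ring

theorem bracket_S3_L2 : ⁅g2VF U (.inl 2), g2VF U (.inl 1)⁆ = 0 := by
  rw [bracket_rootVF (k := 0) (0) fun u n => ?_]
  · rw [zero_smul]
  · fin_cases n <;> simp only [rootField, rootJac, Fin.zero_eta, Fin.mk_one, Fin.reduceFinMk,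
      Fin.isValue, Matrix.cons_val] <;> ring

theorem bracket_L10_S11 : ⁅g2VF U (.inl 9), g2VF U (.inl 10)⁆ = 0 := by
  rw [bracket_rootVF (k := 0) (0) fun u n => ?_]
  · rw [zero_smul]
  · fin_cases n <;> simp only [rootField, rootJac, Fin.zero_eta, Fin.mk_one, Fin.reduceFinMk,
      Fin.isValue, Matrix.cons_val] <;> ring

/-- The opposite string `L⁴, S⁵, S⁷, L⁸`, in the direction of `S⁹`. -/
theorem bracket_S9_L4 : ⁅g2VF U (.inl 8), g2VF U (.inl 3)⁆ = (3 : 𝕜) • g2VF U (.inl 4) := by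
  rw [bracket_rootVF (k := 4) (3) fun u n => ?_]
  fin_cases n <;> simp only [rootField, rootJac, Fin.zero_eta, Fin.mk_one, Fin.reduceFinMk,
      Fin.isValue, Matrix.cons_val] <;> ring

theorem bracket_S9_S5 : ⁅g2VF U (.inl 8), g2VF U (.inl 4)⁆ = -g2VF U (.inl 6) := by
  rw [bracket_rootVF (k := 6) (-1) fun u n => ?_]
  · rw [neg_one_smul]
  · fin_cases n <;> simp only [rootField, rootJac, Fin.zero_eta, Fin.mk_one, Fin.reduceFinMk,
      Fin.isValue, Matrix.cons_val] <;> ring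

theorem bracket_S9_S7 : ⁅g2VF U (.inl 8), g2VF U (.inl 6)⁆ = (-3 : 𝕜) • g2VF U (.inl 7) := by
  rw [bracket_rootVF (k := 7) (-3) fun u n => ?_]
  fin_cases n <;> simp only [rootField, rootJac, Fin.zero_eta, Fin.mk_one, Fin.reduceFinMk,
      Fin.isValue, Matrix.cons_val] <;> ring

theorem bracket_S9_L8 : ⁅g2VF U (.inl 8), g2VF U (.inl 7)⁆ = 0 := by
  rw [bracket_rootVF (k := 0) (0) fun u n => ?_]
  · rw [zero_smul]
  · fin_cases n <;> simp only [rootField, rootJac, Fin.zero_eta, Fin.mk_one, Fin.reduceFinMk,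
      Fin.isValue, Matrix.cons_val] <;> ring

theorem bracket_L4_S5 : ⁅g2VF U (.inl 3), g2VF U (.inl 4)⁆ = 0 := by
  rw [bracket_rootVF (k := 0) (0) fun u n => ?_]
  · rw [zero_smul]
  · fin_cases n <;> simp only [rootField, rootJac, Fin.zero_eta, Fin.mk_one, Fin.reduceFinMk,
      Fin.isValue, Matrix.cons_val] <;> ring

/-- `L¹²` is the highest root vector for the simple roots of `S³` and `L¹⁰`; the last word ends
here. -/
theorem bracket_L10_L2 : ⁅g2VF U (.inl 9), g2VF U (.inl 1)⁆ = g2VF U (.inl 11) := by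
  rw [bracket_rootVF (k := 11) (1) fun u n => ?_]
  · rw [one_smul]
  · fin_cases n <;> simp only [rootField, rootJac, Fin.zero_eta, Fin.mk_one, Fin.reduceFinMk,
      Fin.isValue, Matrix.cons_val] <;> ring

theorem bracket_L4_L8 : ⁅g2VF U (.inl 3), g2VF U (.inl 7)⁆ = -g2VF U (.inl 5) := by
  rw [bracket_rootVF (k := 5) (-1) fun u n => ?_]
  · rw [neg_one_smul]
  · fin_cases n <;> simp only [rootField, rootJac, Fin.zero_eta, Fin.mk_one, Fin.reduceFinMk,
      Fin.isValue, Matrix.cons_val] <;> ring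

theorem bracket_S3_L4 : ⁅g2VF U (.inl 2), g2VF U (.inl 3)⁆ = 0 := by
  rw [bracket_rootVF (k := 0) (0) fun u n => ?_]
  · rw [zero_smul]
  · fin_cases n <;> simp only [rootField, rootJac, Fin.zero_eta, Fin.mk_one, Fin.reduceFinMk,
      Fin.isValue, Matrix.cons_val] <;> ring

theorem bracket_L10_S9 : ⁅g2VF U (.inl 9), g2VF U (.inl 8)⁆ = 0 := by
  rw [bracket_rootVF (k := 0) (0) fun u n => ?_]
  · rw [zero_smul]
  · fin_cases n <;> simp only [rootField, rootJac, Fin.zero_eta, Fin.mk_one, Fin.reduceFinMk,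
      Fin.isValue, Matrix.cons_val] <;> ring

theorem bracket_S3_S9 : ⁅g2VF U (.inl 2), g2VF U (.inl 8)⁆ = (-1 : 𝕜) • g2VF U (.inr 0) := by
  rw [bracket_g2VF (k := .inr 0) (l := .inr 0) (-1) 0 fun u n => ?_]
  · module
  · fin_cases n <;> simp only [g2Jac, g2Field, cartanField, rootField, rootJac, Sum.elim_inl,
      Sum.elim_inr, Fin.zero_eta, Fin.mk_one, Fin.reduceFinMk, Fin.isValue, Matrix.cons_val] <;> ring

theorem bracket_L10_L4 : ⁅g2VF U (.inl 9), g2VF U (.inl 3)⁆ =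
    (-3 : 𝕜) • g2VF U (.inr 0) + (3 / (2 * halfSqrtThree 𝕜)) • g2VF U (.inr 1) := by
  rw [bracket_g2VF (k := .inr 0) (l := .inr 1) (-3) (3 / (2 * halfSqrtThree 𝕜)) fun u n => ?_]
  have := halfSqrtThree_ne_zero 𝕜
  fin_cases n <;> simp only [g2Jac, g2Field, cartanField, rootField, rootJac, Sum.elim_inl,
      Sum.elim_inr, Fin.zero_eta, Fin.mk_one, Fin.reduceFinMk, Fin.isValue, Matrix.cons_val,
      Pi.smul_apply, smul_eq_mul] <;> field_simp <;> ring

end Brackets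

/-! ### The fourteen fields are infinitesimal symmetries -/

section Symmetries

variable {𝕜 : Type*} [RCLike 𝕜]

/-- The derivative of the quartic form `Υ` at `v` in the direction `w`. -/
def structuralTensorDeriv (v w : Coord 𝕜) : 𝕜 :=
  (216 * v 3 ^ 3 + 288 * v 3 ^ 2 * v 0 + 288 * v 3 * v 4 * v 1 + 32 * v 4 ^ 3) * w 0
    + (216 * v 3 ^ 2 * v 4 + 288 * v 3 * v 4 * v 0 - 1152 * v 3 * v 1 ^ 2 - 96 * v 4 ^ 2 * v 1) * w 1
    + (324 * v 3 ^ 3 + 648 * v 3 ^ 2 * v 0 + 432 * v 3 * v 4 * v 1 + 288 * v 3 * v 0 ^ 2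
      + 24 * v 4 ^ 3 + 288 * v 4 * v 0 * v 1 - 384 * v 1 ^ 3) * w 3
    + (216 * v 3 ^ 2 * v 1 + 72 * v 3 * v 4 ^ 2 + 288 * v 3 * v 0 * v 1 + 96 * v 4 ^ 2 * v 0
      - 96 * v 4 * v 1 ^ 2) * w 4

theorem fderiv_fst_coord (w : Coord 𝕜 × Coord 𝕜) (j : Fin 5) :
    fderiv 𝕜 (fun w : Coord 𝕜 × Coord 𝕜 => w.1 j) w =
      (ContinuousLinearMap.proj (R := 𝕜) j).comp (ContinuousLinearMap.fst 𝕜 (Coord 𝕜) (Coord 𝕜)) :=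
  ((ContinuousLinearMap.proj (R := 𝕜) (φ := fun _ : Fin 5 => 𝕜) j).comp
    (ContinuousLinearMap.fst 𝕜 (Coord 𝕜) (Coord 𝕜))).fderiv

theorem fderiv_snd_coord (w : Coord 𝕜 × Coord 𝕜) (j : Fin 5) :
    fderiv 𝕜 (fun w : Coord 𝕜 × Coord 𝕜 => w.2 j) w =
      (ContinuousLinearMap.proj (R := 𝕜) j).comp (ContinuousLinearMap.snd 𝕜 (Coord 𝕜) (Coord 𝕜)) :=
  ((ContinuousLinearMap.proj (R := 𝕜) (φ := fun _ : Fin 5 => 𝕜) j).comp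
    (ContinuousLinearMap.snd 𝕜 (Coord 𝕜) (Coord 𝕜))).fderiv

theorem lieDeriv_contactForm (X : Coord 𝕜 → Coord 𝕜) (u v : Coord 𝕜) :
    lieDeriv X contactForm u v = fderiv 𝕜 X u v 2 - u 3 * fderiv 𝕜 X u v 0
      - u 4 * fderiv 𝕜 X u v 1 - X u 3 * v 0 - X u 4 * v 1 := by
  simp (disch := fun_prop) only [lieDeriv, contactForm, fderiv_fun_sub, fderiv_fun_mul,
    fderiv_fst_coord, fderiv_snd_coord, add_apply, sub_apply, smul_apply,
    ContinuousLinearMap.comp_apply, ContinuousLinearMap.proj_apply, ContinuousLinearMap.coe_fst',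
    ContinuousLinearMap.coe_snd', smul_eq_mul]
  ring

theorem lieDeriv_structuralTensor (X : Coord 𝕜 → Coord 𝕜) (u v : Coord 𝕜) :
    lieDeriv X structuralTensor u v = structuralTensorDeriv v (fderiv 𝕜 X u v) := by
  simp (disch := fun_prop) only [lieDeriv, structuralTensor, structuralTensorDeriv, fderiv_fun_add,
    fderiv_fun_sub, fderiv_fun_mul, fderiv_fun_pow, fderiv_const_apply, zero_apply,
    fderiv_snd_coord, add_apply, sub_apply, smul_apply, nsmul_eq_mul, Nat.cast_ofNat,
    Nat.add_one_sub_one, ContinuousLinearMap.comp_apply, ContinuousLinearMap.proj_apply,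
    ContinuousLinearMap.coe_snd', smul_eq_mul]
  ring

variable {U : TopologicalSpace.Opens (Coord 𝕜)}

variable (U) in
/-- The infinitesimal symmetries on `U`, as a space of vector fields. -/
def symmetrySubmodule : Submodule 𝕜 (smoothVF U) where
  carrier := {X | IsSymmetry U X.1}
  zero_mem' := by
    refine ⟨fun u _ => ⟨0, fun v => ?_⟩, fun u _ => ⟨0, fun v _ => ?_⟩⟩
    · rw [lieDeriv_contactForm]
      simp
    · rw [lieDeriv_structuralTensor]
      simp [structuralTensorDeriv]
  add_mem' := by
    intro X Y hX hY
    have hD : ∀ u ∈ U, ∀ v, fderiv 𝕜 (X + Y).1 u v = fderiv 𝕜 X.1 u v + fderiv 𝕜 Y.1 u v := by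
      intro u hu v
      rw [Submodule.coe_add, fderiv_add (smoothVF_differentiableAt X hu)
        (smoothVF_differentiableAt Y hu)]
      rfl
    refine ⟨fun u hu => ?_, fun u hu => ?_⟩
    · obtain ⟨a, ha⟩ := hX.1 u hu
      obtain ⟨b, hb⟩ := hY.1 u hu
      refine ⟨a + b, fun v => ?_⟩
      have h1 := ha v
      have h2 := hb v
      rw [lieDeriv_contactForm] at h1 h2 ⊢
      rw [hD u hu]
      simp only [Submodule.coe_add, Pi.add_apply]
      linear_combination h1 + h2
    · obtain ⟨a, ha⟩ := hX.2 u hu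
      obtain ⟨b, hb⟩ := hY.2 u hu
      refine ⟨a + b, fun v hv => ?_⟩
      have h1 := ha v hv
      have h2 := hb v hv
      rw [lieDeriv_structuralTensor] at h1 h2 ⊢
      simp only [hD u hu, structuralTensorDeriv, Pi.add_apply] at h1 h2 ⊢
      linear_combination h1 + h2
  smul_mem' := by
    intro c X hX
    have hD : ∀ u ∈ U, ∀ v, fderiv 𝕜 (c • X).1 u v = c • fderiv 𝕜 X.1 u v := by
      intro u hu v
      rw [Submodule.coe_smul, fderiv_const_smul (smoothVF_differentiableAt X hu)]
      rfl
    refine ⟨fun u hu => ?_, fun u hu => ?_⟩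
    · obtain ⟨a, ha⟩ := hX.1 u hu
      refine ⟨c * a, fun v => ?_⟩
      have h1 := ha v
      rw [lieDeriv_contactForm] at h1 ⊢
      rw [hD u hu]
      simp only [Submodule.coe_smul, Pi.smul_apply, smul_eq_mul]
      linear_combination c * h1
    · obtain ⟨a, ha⟩ := hX.2 u hu
      refine ⟨c * a, fun v hv => ?_⟩
      have h1 := ha v hv
      rw [lieDeriv_structuralTensor] at h1 ⊢
      simp only [hD u hu, structuralTensorDeriv, Pi.smul_apply, smul_eq_mul] at h1 ⊢
      linear_combination c * h1

/-- The factors `f` with `L_X ϖ = f ϖ` for the fourteen vector fields. -/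
noncomputable def contactFactor (𝕜 : Type*) [RCLike 𝕜] (i : Fin 12 ⊕ Fin 2) (u : Coord 𝕜) : 𝕜 :=
  Sum.elim ![-3 / 2 * u 1, -u 0 - 3 / 4 * u 3, 0, 0, 0, 0, 0, 0, 0, -3 * u 3, -3 * u 4,
    3 * u 0 * u 3 + 3 * u 1 * u 4 - 6 * u 2] ![0, 2 * halfSqrtThree 𝕜] i

-- If `L_X ϖ = f ϖ`, then `dϖ` scales by `f` on the contact hyperplanes, so the scalar part of the
-- action there is `f / 2`. The remaining part preserves the quartic `Υ`, which therefore scales by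
-- `4 · f / 2 = 2 f`.
set_option maxHeartbeats 2000000 in
theorem g2VF_mem_symmetrySubmodule (i : Fin 12 ⊕ Fin 2) : g2VF U i ∈ symmetrySubmodule U := by
  refine ⟨fun u hu => ⟨contactFactor 𝕜 i u, fun v => ?_⟩,
    fun u hu => ⟨2 * contactFactor 𝕜 i u, fun v hv => ?_⟩⟩
  · rw [lieDeriv_contactForm, fderiv_g2VF i hu, g2VF_apply i hu]
    rcases i with i | i <;> fin_cases i <;>
      simp only [g2Jac, g2Field, cartanField, cartanJac, rootField, rootJac, contactFactor, contactForm,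
        Sum.elim_inl, Sum.elim_inr, Fin.zero_eta, Fin.mk_one, Fin.reduceFinMk, Fin.isValue,
        Matrix.cons_val, Pi.smul_apply, smul_eq_mul] <;>
      ring
  · rw [lieDeriv_structuralTensor, fderiv_g2VF i hu]
    have h2 : v 2 = u 3 * v 0 + u 4 * v 1 := by
      rw [contactForm] at hv
      linear_combination hv
    rcases i with i | i <;> fin_cases i <;>
      simp only [g2Jac, cartanJac, rootJac, contactFactor, structuralTensor, structuralTensorDeriv, h2,
        Sum.elim_inl, Sum.elim_inr, Fin.zero_eta, Fin.mk_one, Fin.reduceFinMk, Fin.isValue,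
        Matrix.cons_val, Pi.smul_apply, smul_eq_mul] <;>
      ring

end Symmetries

/-! ### Smooth functions on `U` and the contact frame as operators -/

section SmoothFunctions

variable {𝕜 : Type*} [RCLike 𝕜]

/-- The smooth functions on an open set `U` of `𝕜⁵`, extended by zero. -/
def smoothFun (U : TopologicalSpace.Opens (Coord 𝕜)) : Submodule 𝕜 (Coord 𝕜 → 𝕜) where
  carrier := {f | ContDiffOn 𝕜 ∞ f U ∧ ∀ u ∉ U, f u = 0}
  add_mem' := by
    rintro f g ⟨hf, hf'⟩ ⟨hg, hg'⟩
    exact ⟨hf.add hg, fun u hu => by simp [hf' u hu, hg' u hu]⟩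
  zero_mem' := ⟨contDiffOn_const, fun _ _ => rfl⟩
  smul_mem' := by
    rintro c f ⟨hf, hf'⟩
    exact ⟨hf.const_smul c, fun u hu => by simp [hf' u hu]⟩

variable {U : TopologicalSpace.Opens (Coord 𝕜)}

theorem smoothFun_contDiffAt (f : smoothFun U) {u : Coord 𝕜} (hu : u ∈ U) :
    ContDiffAt 𝕜 ∞ f.1 u :=
  f.2.1.contDiffAt (U.isOpen.mem_nhds hu)

theorem smoothFun_differentiableAt (f : smoothFun U) {u : Coord 𝕜} (hu : u ∈ U) :
    DifferentiableAt 𝕜 f.1 u :=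
  (smoothFun_contDiffAt f hu).differentiableAt (by simp)

theorem smoothFun_ext {f g : smoothFun U} (h : ∀ u ∈ U, f.1 u = g.1 u) : f = g := by
  apply Subtype.ext
  funext u
  by_cases hu : u ∈ U
  · exact h u hu
  · rw [f.2.2 u hu, g.2.2 u hu]

open Classical in
/-- The partial derivative with respect to the `i`-th coordinate. -/
noncomputable def partialDeriv (i : Fin 5) : smoothFun U →ₗ[𝕜] smoothFun U where
  toFun f := ⟨fun u => if u ∈ U then fderiv 𝕜 f.1 u (Pi.single i 1) else 0, by
    constructor
    · have h : ContDiffOn 𝕜 ∞ (fun u => fderiv 𝕜 f.1 u (Pi.single i 1)) U :=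
        ((f.2.1.fderiv_of_isOpen U.isOpen (m := ∞) (by simp)).clm_apply contDiffOn_const)
      exact h.congr fun u hu => if_pos hu
    · intro u hu
      exact if_neg hu⟩
  map_add' f g := smoothFun_ext fun u hu => by
    have h := fderiv_add (smoothFun_differentiableAt f hu) (smoothFun_differentiableAt g hu)
    simp [show u ∈ U from hu, h]
  map_smul' c f := smoothFun_ext fun u hu => by
    have h := fderiv_const_smul (smoothFun_differentiableAt f hu) c
    simp [show u ∈ U from hu, h]

theorem partialDeriv_apply (i : Fin 5) (f : smoothFun U) {u : Coord 𝕜} (hu : u ∈ U) :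
    (partialDeriv i f).1 u = fderiv 𝕜 f.1 u (Pi.single i 1) :=
  if_pos hu

/-- Multiplication by the `i`-th coordinate. -/
def coordMul (i : Fin 5) : smoothFun U →ₗ[𝕜] smoothFun U where
  toFun f := ⟨fun u => u i * f.1 u, (contDiff_apply 𝕜 𝕜 i).contDiffOn.mul f.2.1,
    fun u hu => mul_eq_zero_of_right _ (f.2.2 u hu)⟩
  map_add' _ _ := smoothFun_ext fun _ _ => mul_add _ _ _
  map_smul' _ _ := smoothFun_ext fun _ _ => mul_left_comm _ _ _

theorem coordMul_apply (i : Fin 5) (f : smoothFun U) (u : Coord 𝕜) :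
    (coordMul i f).1 u = u i * f.1 u := rfl

/-- The value of a function at a point. -/
def evalAt (u : Coord 𝕜) : smoothFun U →ₗ[𝕜] 𝕜 where
  toFun f := f.1 u
  map_add' _ _ := rfl
  map_smul' _ _ := rfl

theorem evalAt_apply (u : Coord 𝕜) (f : smoothFun U) : evalAt u f = f.1 u := rfl

theorem partialDeriv_comm (i j : Fin 5) (f : smoothFun U) :
    partialDeriv i (partialDeriv j f) = partialDeriv j (partialDeriv i f) := by
  refine smoothFun_ext fun u hu => ?_
  have key : ∀ i j : Fin 5, (partialDeriv i (partialDeriv j f)).1 u =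
      fderiv 𝕜 (fderiv 𝕜 f.1) u (Pi.single i 1) (Pi.single j 1) := by
    intro i j
    rw [partialDeriv_apply _ _ hu]
    have h : (partialDeriv j f).1 =ᶠ[𝓝 u] fun w => fderiv 𝕜 f.1 w (Pi.single j 1) := by
      filter_upwards [U.isOpen.mem_nhds hu] with w hw
      exact partialDeriv_apply j f hw
    have hd : DifferentiableAt 𝕜 (fderiv 𝕜 f.1) u :=
      ((smoothFun_contDiffAt f hu).fderiv_right (m := ∞) (by simp)).differentiableAt (by simp)
    rw [h.fderiv_eq, fderiv_clm_apply hd (differentiableAt_const _)]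
    simp
  rw [key, key]
  exact ((smoothFun_contDiffAt f hu).isSymmSndFDerivAt (by
    rw [minSmoothness_of_isRCLikeNormedField]
    exact WithTop.coe_le_coe.2 (le_top (a := (2 : ℕ∞))))) _ _

theorem partialDeriv_coordMul (i j : Fin 5) (f : smoothFun U) :
    partialDeriv i (coordMul j f) = coordMul j (partialDeriv i f) + if i = j then f else 0 := by
  refine smoothFun_ext fun u hu => ?_
  rw [partialDeriv_apply _ _ hu, Submodule.coe_add, Pi.add_apply, coordMul_apply,
    partialDeriv_apply _ _ hu]
  have h : HasFDerivAt (coordMul j f).1 _ u :=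
    (hasFDerivAt_coord 𝕜 j u).mul (smoothFun_differentiableAt f hu).hasFDerivAt
  rw [h.fderiv]
  by_cases hij : i = j
  · subst hij
    simp
  · simp [hij, Ne.symm hij]

theorem fderiv_smoothFun_apply (f : smoothFun U) {u : Coord 𝕜} (hu : u ∈ U) (v : Coord 𝕜) :
    fderiv 𝕜 f.1 u v = ∑ i, v i * (partialDeriv i f).1 u := by
  conv_lhs => rw [pi_eq_sum_univ' v]
  simp only [map_sum, map_smul, smul_eq_mul, partialDeriv_apply _ f hu]

/-- This is where connectedness of `U` enters: a function with zero differential is constant. -/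
theorem smoothFun_eq_zero (hU : IsConnected (U : Set (Coord 𝕜))) {u₀ : Coord 𝕜} (hu₀ : u₀ ∈ U)
    {f : smoothFun U} (hf : ∀ i, partialDeriv i f = 0) (h0 : f.1 u₀ = 0) : f = 0 := by
  refine smoothFun_ext fun u hu => ?_
  have h := U.isOpen.is_const_of_fderiv_eq_zero (𝕜 := 𝕜) hU.isPreconnected
    (f.2.1.differentiableOn (by simp)) (fun w hw => ?_) hu hu₀
  · rw [h, h0]
    rfl
  · ext v
    rw [fderiv_smoothFun_apply f hw]
    simp [hf]

/-- The left-invariant vector fields `E₁ = ∂p - 3/4 (∂x + p ∂z)`, `E₂ = ∂q`, `E₃ = ∂y + q ∂z`,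
`E₄ = ∂x + p ∂z` that span the contact distribution, as differential operators. -/
noncomputable def contactFrame : Fin 4 → (smoothFun U →ₗ[𝕜] smoothFun U) :=
  ![partialDeriv 3 - (3 / 4 : 𝕜) • (partialDeriv 0 + coordMul 3 ∘ₗ partialDeriv 2), partialDeriv 4,
    partialDeriv 1 + coordMul 4 ∘ₗ partialDeriv 2, partialDeriv 0 + coordMul 3 ∘ₗ partialDeriv 2]

theorem contactFrame_zero (g : smoothFun U) : contactFrame 0 g =
    partialDeriv 3 g - (3 / 4 : 𝕜) • (partialDeriv 0 g + coordMul 3 (partialDeriv 2 g)) := rfl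

theorem contactFrame_one (g : smoothFun U) : contactFrame 1 g = partialDeriv 4 g := rfl

theorem contactFrame_two (g : smoothFun U) : contactFrame 2 g =
    partialDeriv 1 g + coordMul 4 (partialDeriv 2 g) := rfl

theorem contactFrame_three (g : smoothFun U) : contactFrame 3 g =
    partialDeriv 0 g + coordMul 3 (partialDeriv 2 g) := rfl

/-- With `∂z` the frame spans a Heisenberg algebra, with `[E₁, E₄] = [E₂, E₃] = ∂z` and all other
brackets zero. Each equation sorts a product into increasing order of indices, so that together they
give a normal form. -/
theorem contactFrame_comm (g : smoothFun U) :
    contactFrame 1 (contactFrame 0 g) = contactFrame 0 (contactFrame 1 g) ∧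
    contactFrame 2 (contactFrame 0 g) = contactFrame 0 (contactFrame 2 g) ∧
    contactFrame 3 (contactFrame 0 g) = contactFrame 0 (contactFrame 3 g) - partialDeriv 2 g ∧
    contactFrame 2 (contactFrame 1 g) = contactFrame 1 (contactFrame 2 g) - partialDeriv 2 g ∧
    contactFrame 3 (contactFrame 1 g) = contactFrame 1 (contactFrame 3 g) ∧
    contactFrame 3 (contactFrame 2 g) = contactFrame 2 (contactFrame 3 g) := by
  have c43 : ∀ g : smoothFun U, coordMul 4 (coordMul 3 g) = coordMul 3 (coordMul 4 g) := fun g =>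
    smoothFun_ext fun u _ => mul_left_comm _ _ _
  refine ⟨?_, ?_, ?_, ?_, ?_, ?_⟩ <;>
    simp only [contactFrame_zero, contactFrame_one, contactFrame_two, contactFrame_three, map_add,
      map_sub, map_smul, partialDeriv_coordMul, c43, partialDeriv_comm 1 0, partialDeriv_comm 2 0,
      partialDeriv_comm 3 0, partialDeriv_comm 4 0, partialDeriv_comm 2 1, partialDeriv_comm 3 1,
      partialDeriv_comm 4 1, partialDeriv_comm 3 2, partialDeriv_comm 4 2, partialDeriv_comm 4 3,
      Fin.isValue, Fin.reduceEq, if_true, if_false, add_zero, smul_add] <;>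
    module

theorem contactFrame_partialDeriv_two (i : Fin 4) (g : smoothFun U) :
    contactFrame i (partialDeriv 2 g) = partialDeriv 2 (contactFrame i g) := by
  fin_cases i <;>
    simp only [Fin.zero_eta, Fin.mk_one, Fin.reduceFinMk, contactFrame_zero, contactFrame_one,
      contactFrame_two, contactFrame_three, map_add, map_sub, map_smul, partialDeriv_coordMul,
      partialDeriv_comm 2 0, partialDeriv_comm 2 1, partialDeriv_comm 3 2, partialDeriv_comm 4 2,
      Fin.isValue, Fin.reduceEq, if_false, add_zero]

/-- The contact distribution is bracket-generating: `∂z` is a commutator of frame fields. -/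
theorem partialDeriv_eq_zero_of_contactFrame {g : smoothFun U} (h : ∀ i, contactFrame i g = 0) :
    ∀ i, partialDeriv i g = 0 := by
  have h2 : partialDeriv 2 g = 0 := by
    have h3 := (contactFrame_comm g).2.2.1
    rw [h 0, h 3, map_zero, map_zero, zero_sub, eq_comm, neg_eq_zero] at h3
    exact h3
  have h0 : partialDeriv 0 g = 0 := by
    have := h 3
    rwa [contactFrame_three, h2, map_zero, add_zero] at this
  have h1 : partialDeriv 1 g = 0 := by
    have := h 2
    rwa [contactFrame_two, h2, map_zero, add_zero] at this
  have h3 : partialDeriv 3 g = 0 := by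
    have := h 0
    rwa [contactFrame_zero, h2, h0, map_zero, add_zero, smul_zero, sub_zero] at this
  have h4 : partialDeriv 4 g = 0 := h 1
  intro i
  fin_cases i <;> assumption

end SmoothFunctions

/-! ### Prolongation of the symmetry equations to a closed system -/

section Prolongation

variable {𝕜 M : Type*} [Field 𝕜] [CharZero 𝕜] [AddCommGroup M] [Module 𝕜 M]

/-- The prolongation of the system of differential equations for the generating function `f` of an
infinitesimal symmetry, in a frame of the contact distribution: `f` is determined by fourteen of its
derivatives at a point, here the functional `ε`. -/
theorem eq_zero_of_jet_eq_zero (E₁ E₂ E₃ E₄ Z : M →ₗ[𝕜] M) (ε : M →ₗ[𝕜] 𝕜)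
    (c21 : ∀ g, E₂ (E₁ g) = E₁ (E₂ g)) (c31 : ∀ g, E₃ (E₁ g) = E₁ (E₃ g))
    (c41 : ∀ g, E₄ (E₁ g) = E₁ (E₄ g) - Z g) (c32 : ∀ g, E₃ (E₂ g) = E₂ (E₃ g) - Z g)
    (c42 : ∀ g, E₄ (E₂ g) = E₂ (E₄ g)) (c43 : ∀ g, E₄ (E₃ g) = E₃ (E₄ g))
    (z1 : ∀ g, E₁ (Z g) = Z (E₁ g)) (z2 : ∀ g, E₂ (Z g) = Z (E₂ g))
    (z3 : ∀ g, E₃ (Z g) = Z (E₃ g)) (z4 : ∀ g, E₄ (Z g) = Z (E₄ g))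
    (const : ∀ g, E₁ g = 0 → E₂ g = 0 → E₃ g = 0 → E₄ g = 0 → ε g = 0 → g = 0) {f : M}
    (r11 : E₁ (E₁ f) = 0) (r12 : E₁ (E₂ f) = 0) (r13 : E₁ (E₃ f) = (3 : 𝕜) • E₂ (E₂ f))
    (r14 : E₁ (E₄ f) = (3 : 𝕜) • E₂ (E₃ f) - Z f) (r33 : E₃ (E₃ f) = (-4 : 𝕜) • E₂ (E₄ f))
    (r34 : E₃ (E₄ f) = 0) (r44 : E₄ (E₄ f) = 0)
    (h0 : ε f = 0) (h1 : ε (E₁ f) = 0) (h2 : ε (E₂ f) = 0) (h3 : ε (E₃ f) = 0) (h4 : ε (E₄ f) = 0)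
    (ha : ε (E₂ (E₂ f)) = 0) (hb : ε (E₂ (E₃ f)) = 0) (hc : ε (E₂ (E₄ f)) = 0) (hz : ε (Z f) = 0)
    (hz1 : ε (Z (E₁ f)) = 0) (hz2 : ε (Z (E₂ f)) = 0) (hz3 : ε (Z (E₃ f)) = 0)
    (hz4 : ε (Z (E₄ f)) = 0) (hzz : ε (Z (Z f)) = 0) : f = 0 := by
  -- Of the ten second derivatives the seven equations leave `a, b, c` free; these are the `sl₂`
  -- directions. The unknowns `f`; `Eᵢ f`; `a, b, c, Z f`; `Z Eᵢ f`; `Z Z f` follow the grading `1 +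
  -- 4 + 4 + 4 + 1`.
  set a := E₂ (E₂ f) with a_def
  set b := E₂ (E₃ f) with b_def
  set c := E₂ (E₄ f) with c_def
  have s32 : E₃ (E₂ f) = b - Z f := c32 f
  have s42 : E₄ (E₂ f) = c := c42 f
  have s43 : E₄ (E₃ f) = 0 := by rw [c43, r34]
  have s21 : E₂ (E₁ f) = 0 := by rw [c21, r12]
  have s31 : E₃ (E₁ f) = (3 : 𝕜) • a := by rw [c31, r13]
  have s41 : E₄ (E₁ f) = (3 : 𝕜) • b - (2 : 𝕜) • Z f := by rw [c41, r14]; module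
  have a1 : E₁ a = 0 := by rw [a_def, ← c21, r12, map_zero]
  have b1 : E₁ b = Z (E₁ f) := by
    have h : b = E₃ (E₂ f) + Z f := by rw [s32]; module
    rw [h, map_add, ← c31, r12, map_zero, zero_add, z1]
  have a2 : E₂ a = (1 / 3 : 𝕜) • Z (E₁ f) := by
    have h := c21 (E₃ f)
    rw [r13, map_smul, ← b_def, b1] at h
    rw [← h]
    module
  have e1 : E₁ c = Z (E₂ f) := by
    have h := c41 (E₂ f)
    rw [r12, map_zero, s42] at h
    linear_combination (norm := module) -h
  have b2 : E₂ b = (2 / 3 : 𝕜) • Z (E₂ f) := by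
    have h := c21 (E₄ f)
    rw [r14, map_sub, map_smul, ← c_def, e1, z2] at h
    linear_combination (norm := module) (1 / 3 : 𝕜) • h
  have a3 : E₃ a = (-4 / 3 : 𝕜) • Z (E₂ f) := by
    rw [a_def, c32, s32, map_sub, b2, z2]
    module
  have a4 : E₄ a = (-1 / 3 : 𝕜) • Z (E₃ f) := by
    have h := c41 (E₃ f)
    rw [r13, s43, map_smul, map_zero] at h
    linear_combination (norm := module) (1 / 3 : 𝕜) • h
  have e2 : E₂ c = (-1 / 3 : 𝕜) • Z (E₃ f) := by rw [← s42, ← c42, ← a_def, a4]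
  have b4 : E₄ b = 0 := by rw [b_def, c42, s43, map_zero]
  have e4 : E₄ c = 0 := by rw [c_def, c42, r44, map_zero]
  have e3 : E₃ c = -Z (E₄ f) := by rw [c_def, c32, r34, map_zero, zero_sub]
  have b3 : E₃ b = (1 / 3 : 𝕜) • Z (E₃ f) := by
    rw [b_def, c32, r33, map_smul, e2]
    module
  -- All first derivatives of `a, b, c` are now multiples of `Z (Eᵢ f)`. The relation `[E₂, E₃] =
  -- Z`, applied to `a, c, b`, is the integrability condition.
  have za : Z a = 0 := by
    have h := c32 a
    rw [a2, a3, map_smul, map_smul, z3, z2, s31, ← a_def, map_smul] at h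
    linear_combination (norm := module) (3 / 10 : 𝕜) • h
  have zc : Z c = 0 := by
    have h := c32 c
    rw [e2, e3, map_smul, map_neg, z3, z2, r33, ← c_def, map_smul] at h
    linear_combination (norm := module) (3 / 10 : 𝕜) • h
  have zb : Z b = (1 / 2 : 𝕜) • Z (Z f) := by
    have h := c32 b
    rw [b2, b3, map_smul, map_smul, z3, z2, s32, ← b_def, map_sub] at h
    linear_combination (norm := module) (3 / 4 : 𝕜) • h
  -- `Z b` is half of `Z (Z f)`, while `E₁ b, …, E₄ b` are `1, 2/3, 1/3, 0` times `Z (Eᵢ f)`. None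
  -- of these factors is `1/2`, so `Z (Z f)` is annihilated by the frame and the system closes.
  have w1 : E₁ (Z (Z f)) = 0 := by
    have h := z1 b
    rw [zb, b1, map_smul, z1, z1] at h
    rw [z1, z1]
    linear_combination (norm := module) (-2 : 𝕜) • h
  have w2 : E₂ (Z (Z f)) = 0 := by
    have h := z2 b
    rw [zb, b2, map_smul, map_smul, z2, z2] at h
    rw [z2, z2]
    linear_combination (norm := module) (-6 : 𝕜) • h
  have w3 : E₃ (Z (Z f)) = 0 := by
    have h := z3 b
    rw [zb, b3, map_smul, map_smul, z3, z3] at h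
    rw [z3, z3]
    linear_combination (norm := module) (6 : 𝕜) • h
  have w4 : E₄ (Z (Z f)) = 0 := by
    have h := z4 b
    rw [zb, b4, map_smul, map_zero] at h
    linear_combination (norm := module) (2 : 𝕜) • h
  -- Descent through the grading: at each level the frame derivatives involve only unknowns already
  -- known to vanish, so `const` applies.
  have zz : Z (Z f) = 0 := const _ w1 w2 w3 w4 hzz
  rw [zz, smul_zero] at zb
  have y1 : Z (E₁ f) = 0 := by
    refine const _ ?_ ?_ ?_ ?_ hz1
    · rw [z1, r11, map_zero]
    · rw [z2, s21, map_zero]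
    · rw [z3, s31, map_smul, za, smul_zero]
    · rw [z4, s41, map_sub, map_smul, map_smul, zb, zz, smul_zero, smul_zero, sub_zero]
  have y2 : Z (E₂ f) = 0 := by
    refine const _ ?_ ?_ ?_ ?_ hz2
    · rw [z1, r12, map_zero]
    · rw [z2, ← a_def, za]
    · rw [z3, s32, map_sub, zb, zz, sub_zero]
    · rw [z4, s42, zc]
  have y3 : Z (E₃ f) = 0 := by
    refine const _ ?_ ?_ ?_ ?_ hz3
    · rw [z1, r13, map_smul, za, smul_zero]
    · rw [z2, ← b_def, zb]
    · rw [z3, r33, map_smul, zc, smul_zero]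
    · rw [z4, s43, map_zero]
  have y4 : Z (E₄ f) = 0 := by
    refine const _ ?_ ?_ ?_ ?_ hz4
    · rw [z1, r14, map_sub, map_smul, zb, zz, smul_zero, sub_zero]
    · rw [z2, ← c_def, zc]
    · rw [z3, r34, map_zero]
    · rw [z4, r44, map_zero]
  simp only [y1, y2, y3, y4, smul_zero, neg_zero] at a1 a2 a3 a4 b1 b2 b3 b4 e1 e2 e3 e4
  have xa : a = 0 := const _ a1 a2 a3 a4 ha
  have xb : b = 0 := const _ b1 b2 b3 b4 hb
  have xc : c = 0 := const _ e1 e2 e3 e4 hc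
  have xz : Z f = 0 := const _ (by rw [z1, y1]) (by rw [z2, y2]) (by rw [z3, y3]) (by rw [z4, y4]) hz
  simp only [xa, xb, xc, xz, smul_zero, sub_zero] at r13 r14 r33 s31 s32 s41 s42 a_def b_def c_def
  have x1 : E₁ f = 0 := const _ r11 s21 s31 s41 h1
  have x2 : E₂ f = 0 := const _ r12 a_def.symm s32 s42 h2
  have x3 : E₃ f = 0 := const _ r13 b_def.symm r33 s43 h3
  have x4 : E₄ f = 0 := const _ r14 c_def.symm r34 r44 h4
  exact const _ x1 x2 x3 x4 h0

end Prolongation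

/-! ### Generating functions of symmetries and the bound `14` -/

section GeneratingFunctions

variable {𝕜 : Type*} [RCLike 𝕜] {U : TopologicalSpace.Opens (Coord 𝕜)}

/-- The `i`-th component of a vector field. -/
def component (i : Fin 5) : smoothVF U →ₗ[𝕜] smoothFun U where
  toFun X := ⟨fun u => X.1 u i, (contDiffOn_pi.1 X.2.1) i, fun u hu => congrFun (X.2.2 u hu) i⟩
  map_add' _ _ := rfl
  map_smul' _ _ := rfl

theorem component_apply (i : Fin 5) (X : smoothVF U) (u : Coord 𝕜) :
    (component i X).1 u = X.1 u i := rfl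

/-- The generating function `ϖ(X)` of a vector field `X`. -/
noncomputable def generatingFun : smoothVF U →ₗ[𝕜] smoothFun U :=
  component 2 - coordMul 3 ∘ₗ component 0 - coordMul 4 ∘ₗ component 1

theorem generatingFun_apply (X : smoothVF U) :
    generatingFun X = component 2 X - coordMul 3 (component 0 X) - coordMul 4 (component 1 X) := rfl

theorem fderiv_smoothVF_apply (X : smoothVF U) {u : Coord 𝕜} (hu : u ∈ U) (v : Coord 𝕜) (k : Fin 5) :
    fderiv 𝕜 X.1 u v k = ∑ i, v i * (partialDeriv i (component k X)).1 u := by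
  rw [← fderiv_apply_coord (smoothVF_differentiableAt X hu)]
  exact fderiv_smoothFun_apply (component k X) hu v

/-- The components of a contact vector field are derivatives of its generating function. -/
theorem component_of_mem_symmetrySubmodule {X : smoothVF U} (hX : X ∈ symmetrySubmodule U) :
    component 0 X = -partialDeriv 3 (generatingFun X) ∧
    component 1 X = -partialDeriv 4 (generatingFun X) ∧
    component 3 X = contactFrame 3 (generatingFun X) ∧
    component 4 X = contactFrame 2 (generatingFun X) := by
  have key : ∀ u ∈ U, ∀ v, contactForm u v = 0 → lieDeriv X.1 contactForm u v = 0 := by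
    intro u hu v hv
    obtain ⟨a, ha⟩ := hX.1 u hu
    rw [ha, hv, mul_zero]
  refine ⟨smoothFun_ext fun u hu => ?_, smoothFun_ext fun u hu => ?_, smoothFun_ext fun u hu => ?_,
    smoothFun_ext fun u hu => ?_⟩
  -- The contact vectors `∂p`, `∂q`, `∂x + p∂z`, `∂y + q∂z` yield one component each.
  · have h := key u hu ![0, 0, 0, 1, 0] (by simp [contactForm])
    rw [lieDeriv_contactForm] at h
    simp only [fderiv_smoothVF_apply X hu] at h
    simp [Fin.sum_univ_five] at h
    simp only [generatingFun_apply, map_sub, partialDeriv_coordMul]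
    simp [component_apply, coordMul_apply]
    linear_combination h
  · have h := key u hu ![0, 0, 0, 0, 1] (by simp [contactForm])
    rw [lieDeriv_contactForm] at h
    simp only [fderiv_smoothVF_apply X hu] at h
    simp [Fin.sum_univ_five] at h
    simp only [generatingFun_apply, map_sub, partialDeriv_coordMul]
    simp [component_apply, coordMul_apply]
    linear_combination h
  · have h := key u hu ![1, 0, u 3, 0, 0] (by simp [contactForm])
    rw [lieDeriv_contactForm] at h
    simp only [fderiv_smoothVF_apply X hu] at h
    simp [Fin.sum_univ_five] at h
    simp only [generatingFun_apply, contactFrame_three, map_sub, partialDeriv_coordMul]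
    simp [component_apply, coordMul_apply]
    linear_combination -h
  · have h := key u hu ![0, 1, u 4, 0, 0] (by simp [contactForm])
    rw [lieDeriv_contactForm] at h
    simp only [fderiv_smoothVF_apply X hu] at h
    simp [Fin.sum_univ_five] at h
    simp only [generatingFun_apply, contactFrame_two, map_sub, partialDeriv_coordMul]
    simp [component_apply, coordMul_apply]
    linear_combination -h

/-- Four components of a contact field are derivatives of `ϖ(X)`, and the `z`-component is then
recovered from `ϖ(X)` itself. -/
theorem generatingFun_injOn {X : smoothVF U} (hX : X ∈ symmetrySubmodule U)
    (h : generatingFun X = 0) : X = 0 := by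
  obtain ⟨h0, h1, h3, h4⟩ := component_of_mem_symmetrySubmodule hX
  have h2 := generatingFun_apply X
  rw [h] at h0 h1 h2 h3 h4
  rw [map_zero] at h0 h1 h3 h4
  rw [neg_zero] at h0 h1
  rw [h0, h1, map_zero, map_zero, sub_zero, sub_zero] at h2
  refine smoothVF_ext fun u _ => funext fun k => ?_
  have hk : component k X = 0 := by
    fin_cases k
    exacts [h0, h1, h2.symm, h3, h4]
  exact congrFun (congrArg Subtype.val hk) u

/-- The differential equations for the generating function of an infinitesimal symmetry. -/
theorem hessian_of_mem_symmetrySubmodule {X : smoothVF U} (hX : X ∈ symmetrySubmodule U)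
    {f : smoothFun U} (hf : f = generatingFun X) :
    contactFrame 0 (contactFrame 0 f) = 0 ∧ contactFrame 0 (contactFrame 1 f) = 0 ∧
    contactFrame 0 (contactFrame 2 f) = (3 : 𝕜) • contactFrame 1 (contactFrame 1 f) ∧
    contactFrame 0 (contactFrame 3 f) =
      (3 : 𝕜) • contactFrame 1 (contactFrame 2 f) - partialDeriv 2 f ∧
    contactFrame 2 (contactFrame 2 f) = (-4 : 𝕜) • contactFrame 1 (contactFrame 3 f) ∧
    contactFrame 2 (contactFrame 3 f) = 0 ∧ contactFrame 3 (contactFrame 3 f) = 0 := by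
  obtain ⟨k0, k1, k3, k4⟩ := component_of_mem_symmetrySubmodule hX
  rw [← hf] at k0 k1 k3 k4
  have k0' : component 0 X = -(contactFrame 0 f + (3 / 4 : 𝕜) • contactFrame 3 f) := by
    rw [k0, contactFrame_zero, contactFrame_three]
    module
  obtain ⟨c21, c31, c41, c32, c42, c43⟩ := contactFrame_comm f
  -- The vector is `∑ aᵢEᵢ` in coordinates, with indices shifted to start at `0`.
  have frame : ∀ u ∈ U, ∀ a : Fin 4 → 𝕜, ∀ k, fderiv 𝕜 X.1 u ![a 3 - 3 / 4 * a 0, a 2,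
      u 3 * (a 3 - 3 / 4 * a 0) + u 4 * a 2, a 0, a 1] k =
        ∑ i, a i * evalAt u (contactFrame i (component k X)) := by
    intro u hu a k
    rw [fderiv_smoothVF_apply X hu]
    simp only [Fin.sum_univ_five, Fin.sum_univ_four, contactFrame_zero, contactFrame_one,
      contactFrame_two, contactFrame_three, map_add, map_sub, map_smul, smul_eq_mul,
      Matrix.cons_val]
    simp only [evalAt_apply, coordMul_apply]
    ring
  -- `Υ` does not involve `dz`, so the `z`-entries are replaced by `0`.
  have main : ∀ u ∈ U, ∃ g, ∀ a : Fin 4 → 𝕜,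
      structuralTensorDeriv ![a 3 - 3 / 4 * a 0, a 2, 0, a 0, a 1]
        ![∑ i, a i * evalAt u (contactFrame i (component 0 X)),
          ∑ i, a i * evalAt u (contactFrame i (component 1 X)), 0,
          ∑ i, a i * evalAt u (contactFrame i (component 3 X)),
          ∑ i, a i * evalAt u (contactFrame i (component 4 X))] =
        g * structuralTensor u ![a 3 - 3 / 4 * a 0, a 2, 0, a 0, a 1] := by
    intro u hu
    obtain ⟨g, hg⟩ := hX.2 u hu
    refine ⟨g, fun a => ?_⟩
    have h := hg ![a 3 - 3 / 4 * a 0, a 2, u 3 * (a 3 - 3 / 4 * a 0) + u 4 * a 2, a 0, a 1]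
      (by simp [contactForm])
    rw [lieDeriv_structuralTensor] at h
    simpa only [structuralTensorDeriv, structuralTensor, frame u hu, Matrix.cons_val] using h
  rw [k0', k1, ← contactFrame_one, k3, k4] at main
  simp only [map_neg, map_add, map_smul, c21, c31, c41, c32, c42, c43, Fin.sum_univ_four, map_sub,
    smul_eq_mul, structuralTensorDeriv, structuralTensor, Matrix.cons_val] at main
  have pointwise : ∀ u ∈ U, evalAt u (contactFrame 0 (contactFrame 0 f)) = 0 ∧
      evalAt u (contactFrame 0 (contactFrame 1 f)) = 0 ∧
      evalAt u (contactFrame 0 (contactFrame 2 f)) =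
        3 * evalAt u (contactFrame 1 (contactFrame 1 f)) ∧
      evalAt u (contactFrame 0 (contactFrame 3 f)) =
        3 * evalAt u (contactFrame 1 (contactFrame 2 f)) - evalAt u (partialDeriv 2 f) ∧
      evalAt u (contactFrame 2 (contactFrame 2 f)) =
        -4 * evalAt u (contactFrame 1 (contactFrame 3 f)) ∧
      evalAt u (contactFrame 2 (contactFrame 3 f)) = 0 ∧
      evalAt u (contactFrame 3 (contactFrame 3 f)) = 0 := by
    intro u hu
    obtain ⟨g, hg⟩ := main u hu
    -- Both sides are quartic in `a`. These eight directions give linear equations for the second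
    -- derivatives, `∂z f` and the unknown factor `g`; the combinations below eliminate `g` and
    -- isolate the seven equations.
    have p0 := hg ![0, 0, 1, 0]
    have p1 := hg ![0, 1, 0, 0]
    have p2 := hg ![0, 0, 1, 1]
    have p3 := hg ![0, 1, 0, 1]
    have p4 := hg ![0, 1, 1, 0]
    have p5 := hg ![1, 0, 0, 1]
    have p6 := hg ![1, 0, 1, 0]
    have p7 := hg ![0, 1, 1, 1]
    simp only [Matrix.cons_val] at p0 p1 p2 p3 p4 p5 p6 p7
    refine ⟨?_, ?_, ?_, ?_, ?_, ?_, ?_⟩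
    · linear_combination 1 / 192 * p0 - 1 / 32 * p1 - 1 / 384 * p2 + 1 / 128 * p3 - 1 / 288 * p5 - 1 / 1536 * p6
    · linear_combination -1 / 32 * p1
    · linear_combination 3 / 32 * p1 + 1 / 128 * p2 + 1 / 128 * p3 + 1 / 512 * p6 - 1 / 32 * p7
    · linear_combination -1 / 384 * p0 - 1 / 32 * p1 - 1 / 64 * p3 - 1 / 768 * p6
    · linear_combination 1 / 128 * p0 + 1 / 96 * p1 - 1 / 384 * p2 - 1 / 96 * p3 - 1 / 96 * p4 + 1 / 96 * p7
    · linear_combination -1 / 384 * p0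
    · linear_combination 1 / 384 * p0 - 1 / 384 * p2
  refine ⟨smoothFun_ext fun u hu => ?_, smoothFun_ext fun u hu => ?_, smoothFun_ext fun u hu => ?_,
    smoothFun_ext fun u hu => ?_, smoothFun_ext fun u hu => ?_, smoothFun_ext fun u hu => ?_,
    smoothFun_ext fun u hu => ?_⟩
  · exact (pointwise u hu).1
  · exact (pointwise u hu).2.1
  · exact (pointwise u hu).2.2.1
  · exact (pointwise u hu).2.2.2.1
  · exact (pointwise u hu).2.2.2.2.1
  · exact (pointwise u hu).2.2.2.2.2.1
  · exact (pointwise u hu).2.2.2.2.2.2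

/-- The fourteen derivatives at a point that determine a generating function. -/
noncomputable def jet (u : Coord 𝕜) : smoothFun U →ₗ[𝕜] Fin 14 → 𝕜 :=
  LinearMap.pi fun i => evalAt u ∘ₗ (![LinearMap.id, contactFrame 0, contactFrame 1, contactFrame 2,
    contactFrame 3, contactFrame 1 ∘ₗ contactFrame 1, contactFrame 1 ∘ₗ contactFrame 2,
    contactFrame 1 ∘ₗ contactFrame 3, partialDeriv 2, partialDeriv 2 ∘ₗ contactFrame 0,
    partialDeriv 2 ∘ₗ contactFrame 1, partialDeriv 2 ∘ₗ contactFrame 2,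
    partialDeriv 2 ∘ₗ contactFrame 3, partialDeriv 2 ∘ₗ partialDeriv 2] :
      Fin 14 → (smoothFun U →ₗ[𝕜] smoothFun U)) i

theorem eq_zero_of_mem_symmetrySubmodule (hU : IsConnected (U : Set (Coord 𝕜))) {u : Coord 𝕜}
    (hu : u ∈ U) {X : smoothVF U} (hX : X ∈ symmetrySubmodule U)
    (h : jet u (generatingFun X) = 0) : X = 0 := by
  obtain ⟨r11, r12, r13, r14, r33, r34, r44⟩ := hessian_of_mem_symmetrySubmodule hX rfl
  have hj : ∀ i, jet u (generatingFun X) i = 0 := fun i => congrFun h i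
  refine generatingFun_injOn hX (eq_zero_of_jet_eq_zero (contactFrame 0) (contactFrame 1)
    (contactFrame 2) (contactFrame 3) (partialDeriv 2) (evalAt u)
    (fun g => (contactFrame_comm g).1) (fun g => (contactFrame_comm g).2.1)
    (fun g => (contactFrame_comm g).2.2.1) (fun g => (contactFrame_comm g).2.2.2.1)
    (fun g => (contactFrame_comm g).2.2.2.2.1) (fun g => (contactFrame_comm g).2.2.2.2.2)
    (contactFrame_partialDeriv_two 0) (contactFrame_partialDeriv_two 1)
    (contactFrame_partialDeriv_two 2) (contactFrame_partialDeriv_two 3) ?_ r11 r12 r13 r14 r33 r34 r44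
    (hj 0) (hj 1) (hj 2) (hj 3) (hj 4) (hj 5) (hj 6) (hj 7) (hj 8) (hj 9) (hj 10) (hj 11) (hj 12)
    (hj 13))
  intro g g0 g1 g2 g3 hg
  refine smoothFun_eq_zero hU hu (partialDeriv_eq_zero_of_contactFrame fun i => ?_) hg
  fin_cases i <;> assumption

/-- On a connected open set every infinitesimal symmetry is a combination of the fourteen fields. -/
theorem span_g2VF (hU : IsConnected (U : Set (Coord 𝕜))) :
    Submodule.span 𝕜 (Set.range (g2VF U)) = symmetrySubmodule U := by
  obtain ⟨u, hu⟩ := hU.nonempty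
  let J : symmetrySubmodule U →ₗ[𝕜] Fin 14 → 𝕜 :=
    jet u ∘ₗ generatingFun ∘ₗ (symmetrySubmodule U).subtype
  -- Injectivity of the jet map bounds the dimension by `14`; the independent fields attain it.
  have hJ : Function.Injective J := by
    rw [← LinearMap.ker_eq_bot, LinearMap.ker_eq_bot']
    intro X hX
    exact Subtype.ext (eq_zero_of_mem_symmetrySubmodule hU hu X.2 hX)
  have : FiniteDimensional 𝕜 (symmetrySubmodule U) := FiniteDimensional.of_injective J hJ
  have hle : Submodule.span 𝕜 (Set.range (g2VF U)) ≤ symmetrySubmodule U :=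
    Submodule.span_le.2 (by rintro _ ⟨i, rfl⟩; exact g2VF_mem_symmetrySubmodule i)
  refine Submodule.eq_of_le_of_finrank_le hle ?_
  rw [finrank_span_eq_card (linearIndependent_g2VF ⟨u, hu⟩)]
  simpa using LinearMap.finrank_le_finrank_of_injective hJ

end GeneratingFunctions

/-! ### Isomorphism with `𝔤₂` and the Cartan subalgebra -/

section Algebra

variable {𝕜 : Type*} [RCLike 𝕜] (U : TopologicalSpace.Opens (Coord 𝕜))

theorem exists_g2_hom_smoothVF :
    ∃ (φ : LieAlgebra.g₂ 𝕜 →ₗ⁅𝕜⁆ smoothVF U) (w : Fin 14 → LieAlgebra.g₂ 𝕜),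
      Submodule.span 𝕜 (Set.range w) = ⊤ ∧ ∀ i, g2VF U i ∈ φ.range := by
  have hs := halfSqrtThree_ne_zero 𝕜
  have W := bracket_cartanVF_rootVF (U := U)
  -- The simple root vectors are `S³` (short) and `L¹⁰` (long). The elements `2h₁` and `-h₁ + h₂/√3`
  -- are their coroots, and the factors `-2` and `1/3` normalize the opposite root vectors so that
  -- the brackets are these coroots.
  obtain ⟨φ, w, hw, hφ⟩ := exists_g2_hom 𝕜 (L := smoothVF U) (a := g2VF U (.inl 2))
    (b := g2VF U (.inl 9)) (f := (-2 : 𝕜) • g2VF U (.inl 8)) (g := (1 / 3 : 𝕜) • g2VF U (.inl 3))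
    (h := (2 : 𝕜) • g2VF U (.inr 0))
    (k := (-1 : 𝕜) • g2VF U (.inr 0) + (1 / (2 * halfSqrtThree 𝕜)) • g2VF U (.inr 1))
    (by simp [bracket_cartanVF])
    (by rw [lie_smul, bracket_S3_S9]; module)
    (by
      rw [lie_smul, bracket_L10_L4]
      match_scalars <;> field_simp)
    (by rw [lie_smul, bracket_L10_S9, smul_zero])
    (by rw [lie_smul, bracket_S3_L4, smul_zero])
    (by simp [W, rootDiagram])
    (by
      simp only [smul_lie, W, rootDiagram, Matrix.cons_val]
      module)
    (by
      simp only [add_lie, smul_lie, W, rootDiagram, Matrix.cons_val]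
      module)
    (by
      simp only [add_lie, smul_lie, W, rootDiagram, Matrix.cons_val]
      match_scalars
      field_simp
      norm_num)
    (by
      simp only [smul_lie, lie_smul, W, rootDiagram, Matrix.cons_val]
      module)
    (by
      simp only [smul_lie, lie_smul, W, rootDiagram, Matrix.cons_val]
      module)
    (by
      simp only [add_lie, smul_lie, lie_smul, W, rootDiagram, Matrix.cons_val]
      module)
    (by
      simp only [add_lie, smul_lie, lie_smul, W, rootDiagram, Matrix.cons_val]
      match_scalars
      field_simp
      norm_num)
    (by simp [bracket_S3_L10, bracket_S3_S11, bracket_S3_S1, bracket_S3_L2])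
    (by simp [bracket_S3_L10, bracket_L10_S11])
    (by simp [bracket_S9_L4, bracket_S9_S5, bracket_S9_S7, bracket_S9_L8])
    (by
      simp only [smul_lie, lie_smul, bracket_S9_L4, bracket_L4_S5, smul_zero])
  refine ⟨φ, w, hw, ?_⟩
  have t0 : φ (w 0) = (2 : 𝕜) • g2VF U (.inr 0) := hφ 0
  have t1 : φ (w 1) = (-1 : 𝕜) • g2VF U (.inr 0) +
    (1 / (2 * halfSqrtThree 𝕜)) • g2VF U (.inr 1) := hφ 1
  have t2 : φ (w 2) = g2VF U (.inl 2) := hφ 2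
  have t3 : φ (w 3) = g2VF U (.inl 9) := hφ 3
  have t4 : φ (w 4) = (1 / 2 : 𝕜) • g2VF U (.inl 10) := (hφ 4).trans bracket_S3_L10
  have t5 : φ (w 5) = (-2 : 𝕜) • g2VF U (.inl 0) := by
    have h : φ (w 5) = ⁅g2VF U (.inl 2), φ (w 4)⁆ := by rw [hφ 4]; exact hφ 5
    rw [h, t4, lie_smul, bracket_S3_S11]
    module
  have t6 : φ (w 6) = (3 / 2 : 𝕜) • g2VF U (.inl 1) := by
    have h : φ (w 6) = ⁅g2VF U (.inl 2), φ (w 5)⁆ := by rw [hφ 5]; exact hφ 6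
    rw [h, t5, lie_smul, bracket_S3_S1]
    module
  have t7 : φ (w 7) = (3 / 2 : 𝕜) • g2VF U (.inl 11) := by
    have h : φ (w 7) = ⁅g2VF U (.inl 9), φ (w 6)⁆ := by rw [hφ 6]; exact hφ 7
    rw [h, t6, lie_smul, bracket_L10_L2]
  have t8 : φ (w 8) = (-2 : 𝕜) • g2VF U (.inl 8) := hφ 8
  have t9 : φ (w 9) = (1 / 3 : 𝕜) • g2VF U (.inl 3) := hφ 9
  have t10 : φ (w 10) = (-2 : 𝕜) • g2VF U (.inl 4) := by
    have h : φ (w 10) = ⁅φ (w 8), φ (w 9)⁆ := by rw [hφ 8, hφ 9]; exact hφ 10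
    rw [h, t8, t9, smul_lie, lie_smul, bracket_S9_L4]
    module
  have t11 : φ (w 11) = (-4 : 𝕜) • g2VF U (.inl 6) := by
    have h : φ (w 11) = ⁅φ (w 8), φ (w 10)⁆ := by rw [hφ 8, hφ 10]; exact hφ 11
    rw [h, t8, t10, smul_lie, lie_smul, bracket_S9_S5]
    module
  have t12 : φ (w 12) = (-24 : 𝕜) • g2VF U (.inl 7) := by
    have h : φ (w 12) = ⁅φ (w 8), φ (w 11)⁆ := by rw [hφ 8, hφ 11]; exact hφ 12
    rw [h, t8, t11, smul_lie, lie_smul, bracket_S9_S7]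
    module
  have t13 : φ (w 13) = (8 : 𝕜) • g2VF U (.inl 5) := by
    have h : φ (w 13) = ⁅φ (w 9), φ (w 12)⁆ := by rw [hφ 9, hφ 12]; exact hφ 13
    rw [h, t9, t12, smul_lie, lie_smul, bracket_L4_L8]
    module
  have of_smul : ∀ (c : 𝕜) (x : LieAlgebra.g₂ 𝕜) (Y : smoothVF U), c ≠ 0 → φ x = c • Y →
      Y ∈ φ.range := fun c x Y hc h => ⟨c⁻¹ • x, by
    change φ (c⁻¹ • x) = Y
    rw [map_smul, h, inv_smul_smul₀ hc]⟩
  have h1 : g2VF U (.inr 0) ∈ φ.range := of_smul _ _ _ (by norm_num) t0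
  rintro (i | i) <;> fin_cases i
  · exact of_smul _ _ _ (by norm_num) t5
  · exact of_smul _ _ _ (by norm_num) t6
  · exact ⟨w 2, t2⟩
  · exact of_smul _ _ _ (by norm_num) t9
  · exact of_smul _ _ _ (by norm_num) t10
  · exact of_smul _ _ _ (by norm_num) t13
  · exact of_smul _ _ _ (by norm_num) t11
  · exact of_smul _ _ _ (by norm_num) t12
  · exact of_smul _ _ _ (by norm_num) t8
  · exact ⟨w 3, t3⟩
  · exact of_smul _ _ _ (by norm_num) t4
  · exact of_smul _ _ _ (by norm_num) t7
  · exact h1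
  -- Adding half of the short coroot to the long one cancels `h₁`.
  · refine of_smul (1 / (2 * halfSqrtThree 𝕜)) (w 1 + (1 / 2 : 𝕜) • w 0) _ (by simp [hs]) ?_
    rw [map_add, map_smul, t0, t1]
    simp only [Fin.mk_one]
    module

variable {U}

/-- The algebra is taken to be the range of `φ`. Since `dim 𝔤₂ ≤ 14` and the range contains the
`14`-dimensional space of symmetries, the two coincide and `φ` is injective; closure under the
bracket comes for free. -/
theorem exists_symmetryAlgebra (hU : IsConnected (U : Set (Coord 𝕜))) :
    ∃ 𝔤 : LieSubalgebra 𝕜 (smoothVF U),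
      (∀ X : smoothVF U, X ∈ 𝔤 ↔ IsSymmetry U (X : Coord 𝕜 → Coord 𝕜)) ∧
      Nonempty (𝔤 ≃ₗ⁅𝕜⁆ LieAlgebra.g₂ 𝕜) ∧
      ∃ b : Module.Basis (Fin 12 ⊕ Fin 2) 𝕜 𝔤, ∀ i, (b i : smoothVF U) = g2VF U i := by
  obtain ⟨φ, w, hw, hφ⟩ := exists_g2_hom_smoothVF U
  have hli := linearIndependent_g2VF hU.nonempty
  have : FiniteDimensional 𝕜 (LieAlgebra.g₂ 𝕜) :=
    Module.finite_def.2 (hw ▸ Submodule.fg_span (Set.finite_range w))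
  have hdim : Module.finrank 𝕜 (LieAlgebra.g₂ 𝕜) ≤ 14 := by
    have h := finrank_range_le_card (R := 𝕜) w
    rwa [Set.finrank, hw, finrank_top, Fintype.card_fin] at h
  have hle : Submodule.span 𝕜 (Set.range (g2VF U)) ≤
      LinearMap.range (φ : LieAlgebra.g₂ 𝕜 →ₗ[𝕜] smoothVF U) :=
    Submodule.span_le.2 (by rintro _ ⟨i, rfl⟩; exact hφ i)
  have hcard : Module.finrank 𝕜 (Submodule.span 𝕜 (Set.range (g2VF U))) = 14 := by
    rw [finrank_span_eq_card hli]
    rfl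
  have hrn := LinearMap.finrank_range_add_finrank_ker (φ : LieAlgebra.g₂ 𝕜 →ₗ[𝕜] smoothVF U)
  have hmono := Submodule.finrank_mono hle
  have hrange : LinearMap.range (φ : LieAlgebra.g₂ 𝕜 →ₗ[𝕜] smoothVF U) = symmetrySubmodule U := by
    rw [← span_g2VF hU]
    exact (Submodule.eq_of_le_of_finrank_le hle (by omega)).symm
  have hinj : Function.Injective φ := by
    have h : Module.finrank 𝕜 (LinearMap.ker (φ : LieAlgebra.g₂ 𝕜 →ₗ[𝕜] smoothVF U)) = 0 := by omega
    exact LinearMap.ker_eq_bot.1 (Submodule.finrank_eq_zero.1 h)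
  have mem : ∀ X, X ∈ φ.range ↔ X ∈ symmetrySubmodule U := fun X => by
    rw [← hrange]
    rfl
  let v : Fin 12 ⊕ Fin 2 → φ.range := fun i => ⟨g2VF U i, (mem _).2 (g2VF_mem_symmetrySubmodule i)⟩
  have hv : LinearIndependent 𝕜 v :=
    LinearIndependent.of_comp φ.range.toSubmodule.subtype hli
  have hspan : ⊤ ≤ Submodule.span 𝕜 (Set.range v) := by
    rintro ⟨X, hX⟩ -
    have hX' := (mem X).1 hX
    rw [← span_g2VF hU] at hX'
    obtain ⟨c, hc⟩ := (Submodule.mem_span_range_iff_exists_fun 𝕜).1 hX'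
    refine (Submodule.mem_span_range_iff_exists_fun 𝕜).2 ⟨c, Subtype.ext ?_⟩
    refine Eq.trans ?_ hc
    change φ.range.toSubmodule.subtype (∑ i, c i • v i) = _
    rw [map_sum]
    rfl
  refine ⟨φ.range, mem, ⟨(LieEquiv.ofInjective φ hinj).symm⟩, Module.Basis.mk hv hspan, fun i => ?_⟩
  rw [Module.Basis.mk_apply]

/-- A two-dimensional abelian subalgebra of a Lie algebra that acts diagonally, without a common zero
weight on a complement, is a Cartan subalgebra. -/
theorem exists_isCartanSubalgebra {L : Type*} [LieRing L] [LieAlgebra 𝕜 L] {ι : Type*} [Fintype ι]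
    (b : Module.Basis (ι ⊕ Fin 2) 𝕜 L) (hb : ⁅b (.inr 0), b (.inr 1)⁆ = 0) (α : ι → Fin 2 → 𝕜)
    (hα : ∀ k, α k ≠ 0) (h : ∀ j k, ⁅b (.inr j), b (.inl k)⁆ = α k j • b (.inl k)) :
    ∃ 𝔥 : LieSubalgebra 𝕜 L, 𝔥.IsCartanSubalgebra ∧
      𝔥.toSubmodule = Submodule.span 𝕜 (Set.range fun j : Fin 2 => b (.inr j)) := by
  have hb' : ∀ i j : Fin 2, ⁅b (.inr i), b (.inr j)⁆ = 0 := by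
    intro i j
    fin_cases i <;> fin_cases j
    · exact lie_self _
    · exact hb
    · change ⁅b (.inr 1), b (.inr 0)⁆ = 0
      rw [← lie_skew, hb, neg_zero]
    · exact lie_self _
  set S := Submodule.span 𝕜 (Set.range fun j : Fin 2 => b (.inr j)) with hS
  have comm : ∀ x ∈ S, ∀ y ∈ S, ⁅x, y⁆ = 0 := by
    intro x hx y hy
    obtain ⟨c, rfl⟩ := (Submodule.mem_span_range_iff_exists_fun 𝕜).1 hx
    obtain ⟨d, rfl⟩ := (Submodule.mem_span_range_iff_exists_fun 𝕜).1 hy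
    simp [Fin.sum_univ_two, hb']
  have repr_zero : ∀ x ∈ S, ∀ k, b.repr x (.inl k) = 0 := by
    intro x hx k
    obtain ⟨c, rfl⟩ := (Submodule.mem_span_range_iff_exists_fun 𝕜).1 hx
    simp
  let 𝔥 : LieSubalgebra 𝕜 L :=
    { S with
      lie_mem' := fun {x y} hx hy => by
        have hxy := comm x hx y hy
        simp [hxy] }
  refine ⟨𝔥, ⟨?_, ?_⟩, rfl⟩
  · have : IsLieAbelian 𝔥 := ⟨fun x y => Subtype.ext (comm _ x.2 _ y.2)⟩
    infer_instance
  -- Self-normalizing: if `⁅h_j, x⁆` lies in `S`, then `α k j` times the `k`-th root coordinate of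
  -- `x` vanishes, and some `α k j` is non-zero.
  · refine le_antisymm (fun x hx => ?_) 𝔥.le_normalizer
    rw [LieSubalgebra.mem_normalizer_iff'] at hx
    have hbr : ∀ j k, b.repr ⁅b (.inr j), x⁆ (.inl k) = α k j * b.repr x (.inl k) := by
      intro j k
      have hsum : ⁅b (.inr j), x⁆ = ∑ k, (b.repr x (.inl k) * α k j) • b (.inl k) := by
        conv_lhs => rw [← b.sum_repr x, Fintype.sum_sum_type]
        simp only [lie_add, lie_sum, lie_smul, h, hb', smul_smul, smul_zero, Finset.sum_const_zero,
          add_zero]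
      classical
      simp [hsum, Finsupp.single_apply, mul_comm]
    have hz : ∀ k, b.repr x (.inl k) = 0 := by
      intro k
      obtain ⟨j, hj⟩ := Function.ne_iff.1 (hα k)
      have h1 := repr_zero _ (hx (b (.inr j)) (Submodule.subset_span ⟨j, rfl⟩)) k
      rw [hbr] at h1
      exact (mul_eq_zero.1 h1).resolve_left hj
    change x ∈ S
    rw [← b.sum_repr x, Fintype.sum_sum_type]
    simp only [hz, zero_smul, Finset.sum_const_zero, zero_add]
    exact Submodule.sum_mem _ fun j _ => Submodule.smul_mem _ _ (Submodule.subset_span ⟨j, rfl⟩)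

theorem rootDiagram_ne_zero (k : Fin 12) : rootDiagram 𝕜 k ≠ 0 := by
  have hs := halfSqrtThree_ne_zero 𝕜
  intro h
  have h0 := congrFun h 0
  have h1 := congrFun h 1
  fin_cases k <;> simp [rootDiagram, hs] at h0 h1

end Algebra

/-! ### The curve, Noth's equation and the vanishing of `Υ` -/

section NothCurve

variable {𝕜 : Type*} [RCLike 𝕜]

/-- The parameter values at which the curve is the graph of a smooth function. -/
def regularParameters (𝕜 : Type*) [RCLike 𝕜] : Set 𝕜 := {r | r ≠ 0 ∧ 1 - r ^ 3 ≠ 0 ∧ 1 + 2 * r ^ 3 ≠ 0}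

theorem isOpen_regularParameters : IsOpen (regularParameters 𝕜) :=
  (isOpen_ne_fun continuous_id continuous_const).inter
    ((isOpen_ne_fun (by fun_prop) continuous_const).inter
      (isOpen_ne_fun (by fun_prop) continuous_const))

/-- The derivative of `t` with respect to the parameter `r`. -/
noncomputable def curveSpeed (r : 𝕜) : 𝕜 := 4 * r * (1 - r ^ 3) / (1 + 2 * r ^ 3) ^ 2

theorem curveSpeed_ne_zero {r : 𝕜} (hr : r ∈ regularParameters 𝕜) : curveSpeed r ≠ 0 := by
  obtain ⟨h0, h1, h2⟩ := hr
  have : (4 : 𝕜) ≠ 0 := by norm_num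
  unfold curveSpeed
  positivity

/-- All `t`-derivatives of `H` from the first on have this shape, and dividing by `curveSpeed`
preserves it; only the numerator `N` changes. -/
theorem hasDerivAt_quotient {N : 𝕜 → 𝕜} {N' r : 𝕜} (hr : r ∈ regularParameters 𝕜) (k a b : ℕ)
    (hN : HasDerivAt N N' r) :
    HasDerivAt (fun r : 𝕜 => (1 + 2 * r ^ 3) ^ k * N r / (r ^ a * (1 - r ^ 3) ^ b))
      ((1 + 2 * r ^ 3) ^ k * (6 * k * r ^ 3 * (1 - r ^ 3) * N r
        + (1 + 2 * r ^ 3) * (1 - r ^ 3) * r * N' - a * (1 + 2 * r ^ 3) * (1 - r ^ 3) * N r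
        + 3 * b * r ^ 3 * (1 + 2 * r ^ 3) * N r) /
          (r ^ a * (1 - r ^ 3) ^ b * ((1 + 2 * r ^ 3) * r * (1 - r ^ 3)))) r := by
  obtain ⟨h0, h1, h2⟩ := hr
  -- Removes the truncated exponent `n - 1`; for `n = 0` both sides are zero.
  have hpow : ∀ (n : ℕ) (x : 𝕜), x ≠ 0 → (n : 𝕜) * x ^ (n - 1) = n * x ^ n / x := by
    intro n x hx
    rcases n with _ | n
    · simp
    · rw [Nat.add_sub_cancel, pow_succ]
      field_simp
  have d1 : HasDerivAt (fun r : 𝕜 => 1 + 2 * r ^ 3) (2 * (3 * r ^ 2)) r := by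
    simpa using ((hasDerivAt_pow 3 r).const_mul 2).const_add 1
  have d2 : HasDerivAt (fun r : 𝕜 => 1 - r ^ 3) (-(3 * r ^ 2)) r := by
    simpa using (hasDerivAt_pow 3 r).const_sub 1
  have d := ((d1.fun_pow k).fun_mul hN).fun_div ((hasDerivAt_pow a r).fun_mul (d2.fun_pow b))
    (mul_ne_zero (pow_ne_zero a h0) (pow_ne_zero b h1))
  refine d.congr_deriv ?_
  rw [hpow k _ h2, hpow a _ h0, hpow b _ h1]
  field_simp
  ring

theorem hasDerivAt_curveT {r : 𝕜} (hr : 1 + 2 * r ^ 3 ≠ 0) :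
    HasDerivAt curveT (curveSpeed r) r := by
  have h1 : HasDerivAt (fun r : 𝕜 => 2 * r ^ 2) (2 * (2 * r)) r := by
    simpa using (hasDerivAt_pow 2 r).const_mul 2
  have h2 : HasDerivAt (fun r : 𝕜 => 1 + 2 * r ^ 3) (2 * (3 * r ^ 2)) r := by
    simpa using ((hasDerivAt_pow 3 r).const_mul 2).const_add 1
  refine (h1.fun_div h2 hr).congr_deriv ?_
  unfold curveSpeed
  field_simp
  ring

theorem contDiffAt_curveT {r : 𝕜} (hr : 1 + 2 * r ^ 3 ≠ 0) : ContDiffAt 𝕜 ∞ curveT r := by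
  unfold curveT
  exact (by fun_prop : ContDiffAt 𝕜 ∞ (fun r : 𝕜 => 2 * r ^ 2) r).div (by fun_prop) hr

theorem contDiffAt_curveH {r : 𝕜} (hr : 1 + 2 * r ^ 3 ≠ 0) : ContDiffAt 𝕜 ∞ curveH r := by
  unfold curveH
  exact (by fun_prop : ContDiffAt 𝕜 ∞ (fun r : 𝕜 => -4 * r) r).div (by fun_prop) hr

/-- The antiderivative of `H` along the curve, as a function of the parameter. -/
noncomputable def curveG (r : 𝕜) : 𝕜 := 2 * (1 - 4 * r ^ 3) / (3 * (1 + 2 * r ^ 3) ^ 2)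

theorem hasDerivAt_curveG {r : 𝕜} (hr : 1 + 2 * r ^ 3 ≠ 0) :
    HasDerivAt curveG (curveH r * curveSpeed r) r := by
  have h1 : HasDerivAt (fun r : 𝕜 => 2 * (1 - 4 * r ^ 3)) (2 * -(4 * (3 * r ^ 2))) r := by
    simpa using (((hasDerivAt_pow 3 r).const_mul 4).const_sub 1).const_mul 2
  have h2 : HasDerivAt (fun r : 𝕜 => 3 * (1 + 2 * r ^ 3) ^ 2)
      (3 * (2 * (1 + 2 * r ^ 3) * (2 * (3 * r ^ 2)))) r := by
    simpa using ((((hasDerivAt_pow 3 r).const_mul 2).const_add 1).pow 2).const_mul 3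
  refine (h1.fun_div h2 (mul_ne_zero three_ne_zero (pow_ne_zero 2 hr))).congr_deriv ?_
  unfold curveSpeed curveH
  field_simp
  ring

/-- The derivatives of `H` with respect to `t`, as functions of the parameter. -/
noncomputable def curveDeriv (n : Fin 7) (r : 𝕜) : 𝕜 :=
  ![curveH r,
    (1 + 2 * r ^ 3) ^ 0 * (4 * r ^ 3 - 1) / (r ^ 1 * (1 - r ^ 3) ^ 1),
    (1 + 2 * r ^ 3) ^ 4 * (1 / 4) / (r ^ 3 * (1 - r ^ 3) ^ 3),
    (1 + 2 * r ^ 3) ^ 5 * (3 / 16 * (10 * r ^ 3 - 1)) / (r ^ 5 * (1 - r ^ 3) ^ 5),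
    (1 + 2 * r ^ 3) ^ 6 * (15 / 64 * (8 * r ^ 9 + 84 * r ^ 6 - 12 * r ^ 3 + 1)) /
      (r ^ 7 * (1 - r ^ 3) ^ 7),
    (1 + 2 * r ^ 3) ^ 7 * (15 / 256 * (16 * r ^ 15 + 1144 * r ^ 12 + 4552 * r ^ 9 - 700 * r ^ 6
      + 98 * r ^ 3 - 7)) / (r ^ 9 * (1 - r ^ 3) ^ 9),
    (1 + 2 * r ^ 3) ^ 8 * (945 / 1024 * (128 * r ^ 18 + 2176 * r ^ 15 + 4840 * r ^ 12 - 696 * r ^ 9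
      + 128 * r ^ 6 - 16 * r ^ 3 + 1)) / (r ^ 11 * (1 - r ^ 3) ^ 11)] n

/-- The chain rule `d/dr = t'(r) d/dt`: this recursion is what justifies the table of derivatives.
-/
theorem hasDerivAt_curveDeriv {r : 𝕜} (hr : r ∈ regularParameters 𝕜) (n : Fin 6) :
    HasDerivAt (curveDeriv n.castSucc) (curveDeriv n.succ r * curveSpeed r) r := by
  have hr' := hr
  obtain ⟨h0, h1, h2⟩ := hr'
  have P : ∀ m : ℕ, HasDerivAt (fun r : 𝕜 => r ^ m) (m * r ^ (m - 1)) r := fun m => hasDerivAt_pow m r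
  fin_cases n
  · have d1 : HasDerivAt (fun r : 𝕜 => -4 * r) (-4) r := by
      simpa using (hasDerivAt_id r).const_mul (-4)
    have d2 : HasDerivAt (fun r : 𝕜 => 1 + 2 * r ^ 3) (2 * (3 * r ^ 2)) r := by
      simpa using ((hasDerivAt_pow 3 r).const_mul 2).const_add 1
    refine (d1.fun_div d2 h2).congr_deriv ?_
    simp [curveDeriv, curveSpeed]
    field_simp
    ring
  · refine (hasDerivAt_quotient hr 0 1 1 (((P 3).const_mul 4).sub_const 1)).congr_deriv ?_
    simp [curveDeriv, curveSpeed]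
    field_simp
    ring
  · refine (hasDerivAt_quotient hr 4 3 3 (hasDerivAt_const r (1 / 4))).congr_deriv ?_
    simp [curveDeriv, curveSpeed]
    field_simp
    ring
  · refine (hasDerivAt_quotient hr 5 5 5
      ((((P 3).const_mul 10).sub_const 1).const_mul (3 / 16))).congr_deriv ?_
    simp [curveDeriv, curveSpeed]
    field_simp
    ring
  · refine (hasDerivAt_quotient hr 6 7 7 ((((((P 9).const_mul 8).fun_add ((P 6).const_mul 84)).fun_sub
      ((P 3).const_mul 12)).add_const 1).const_mul (15 / 64))).congr_deriv ?_
    simp [curveDeriv, curveSpeed]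
    field_simp
    ring
  · refine (hasDerivAt_quotient hr 7 9 9 (((((((((P 15).const_mul 16).fun_add
      ((P 12).const_mul 1144)).fun_add ((P 9).const_mul 4552)).fun_sub ((P 6).const_mul 700)).fun_add
      ((P 3).const_mul 98)).sub_const 7)).const_mul (15 / 256))).congr_deriv ?_
    simp [curveDeriv, curveSpeed]
    field_simp
    ring

theorem curveDeriv_noth {r : 𝕜} (hr : r ∈ regularParameters 𝕜) :
    10 * curveDeriv 2 r ^ 3 * curveDeriv 6 r - 70 * curveDeriv 2 r ^ 2 * curveDeriv 3 r * curveDeriv 5 r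
      - 49 * curveDeriv 2 r ^ 2 * curveDeriv 4 r ^ 2
      + 280 * curveDeriv 2 r * curveDeriv 3 r ^ 2 * curveDeriv 4 r - 175 * curveDeriv 3 r ^ 4 = 0 := by
  obtain ⟨h0, h1, h2⟩ := hr
  simp only [curveDeriv, Matrix.cons_val]
  field_simp
  ring

theorem structuralTensor_eq_zero_of_curve {r : 𝕜} (hr : r ∈ regularParameters 𝕜) (u v : Coord 𝕜)
    (h3 : v 3 + (curveT r ^ 2 * curveDeriv 1 r - 2 * curveT r * curveH r + 2 * curveG r) * v 0
      + (curveH r - curveT r * curveDeriv 1 r) * v 1 = 0)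
    (h4 : v 4 + (curveH r - curveT r * curveDeriv 1 r) * v 0 + curveDeriv 1 r * v 1 = 0) :
    structuralTensor u v = 0 := by
  obtain ⟨k0, k1, k2⟩ := hr
  -- The constant of integration in `curveG` matters here: with it the coefficient of `dx` in `ω₂`
  -- reduces to `4 / (3(1 - r³))`.
  have e1 : curveT r ^ 2 * curveDeriv 1 r - 2 * curveT r * curveH r + 2 * curveG r =
      4 / (3 * (1 - r ^ 3)) := by
    simp only [curveT, curveDeriv, curveH, curveG, Matrix.cons_val]
    field_simp
    ring
  have e2 : curveH r - curveT r * curveDeriv 1 r = -2 * r / (1 - r ^ 3) := by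
    have k3 := mul_ne_zero k2 (mul_ne_zero k0 k1)
    simp only [curveT, curveDeriv, curveH, Matrix.cons_val, pow_zero, one_mul, pow_one]
    rw [div_mul_div_comm, div_sub_div _ _ k2 k3, div_eq_div_iff (mul_ne_zero k2 k3) k1]
    ring
  have e3 : curveDeriv 1 r = (4 * r ^ 3 - 1) / (r * (1 - r ^ 3)) := by
    simp only [curveDeriv, Matrix.cons_val]
    field_simp
  rw [e1, e2] at h3
  rw [e2, e3] at h4
  have h3' : v 3 = -(4 / (3 * (1 - r ^ 3))) * v 0 - -2 * r / (1 - r ^ 3) * v 1 := by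
    linear_combination h3
  have h4' : v 4 = -(-2 * r / (1 - r ^ 3)) * v 0 - (4 * r ^ 3 - 1) / (r * (1 - r ^ 3)) * v 1 := by
    linear_combination h4
  simp only [structuralTensor]
  rw [h3', h4']
  field_simp
  ring

/-- The speed `4r(1 - r³)/(1 + 2r³)²` is non-zero at the allowed parameters, so the inverse function
theorem gives `r` as a function of `t`, and `H`, `G` are `curveH`, `curveG` composed with it. -/
theorem associatedToNothCurve (𝕜 : Type*) [RCLike 𝕜] : AssociatedToNothCurve 𝕜 := by
  intro r₀ h0 h1 h2
  have hr₀ : r₀ ∈ regularParameters 𝕜 := ⟨h0, sub_ne_zero.2 (Ne.symm h1), h2⟩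
  set e := (contDiffAt_curveT h2).toOpenPartialHomeomorph curveT
    ((hasDerivAt_curveT h2).hasFDerivAt_equiv (curveSpeed_ne_zero hr₀)) (by simp) with he
  have hcoe : ⇑e = curveT := rfl
  have hsource : r₀ ∈ e.source := ContDiffAt.mem_toOpenPartialHomeomorph_source _ _ _
  -- `V` is open, so the formula for the `n`-th derivative holds near each of its points and can be
  -- differentiated again in the induction.
  set V := e.target ∩ e.symm ⁻¹' regularParameters 𝕜 with hV
  have hVo : IsOpen V := e.symm.isOpen_inter_preimage isOpen_regularParameters
  have hinv : ∀ t ∈ V, HasDerivAt e.symm (curveSpeed (e.symm t))⁻¹ t := fun t ht =>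
    e.hasDerivAt_symm ht.1 (curveSpeed_ne_zero ht.2) (hasDerivAt_curveT ht.2.2.2)
  have hiter : ∀ (n : ℕ) (hn : n < 7), ∀ t ∈ V,
      iteratedDeriv n (fun t => curveH (e.symm t)) t = curveDeriv ⟨n, hn⟩ (e.symm t) := by
    intro n
    induction n with
    | zero =>
      intro _ t _
      rw [iteratedDeriv_zero]
      rfl
    | succ n ih =>
      intro hn t ht
      have hev : iteratedDeriv n (fun t => curveH (e.symm t)) =ᶠ[𝓝 t]
          fun t => curveDeriv ⟨n, by omega⟩ (e.symm t) := by
        filter_upwards [hVo.mem_nhds ht] with w hw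
        exact ih (by omega) w hw
      rw [iteratedDeriv_succ, hev.deriv_eq]
      have hd := (hasDerivAt_curveDeriv ht.2 ⟨n, by omega⟩).comp t (hinv t ht)
      refine hd.deriv.trans ?_
      rw [mul_inv_cancel_right₀ (curveSpeed_ne_zero ht.2)]
      rfl
  have hH : ∀ t ∈ V, ContDiffAt 𝕜 ∞ (fun t => curveH (e.symm t)) t := fun t ht =>
    (contDiffAt_curveH ht.2.2.2).comp t (e.contDiffAt_symm_deriv (curveSpeed_ne_zero ht.2) ht.1
      (hasDerivAt_curveT ht.2.2.2) (contDiffAt_curveT ht.2.2.2))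
  have hG : ∀ t ∈ V, HasDerivAt (fun t => curveG (e.symm t)) (curveH (e.symm t)) t := fun t ht =>
    ((hasDerivAt_curveG ht.2.2.2).comp t (hinv t ht)).congr_deriv
      (mul_inv_cancel_right₀ (curveSpeed_ne_zero ht.2) _)
  refine ⟨fun t => curveH (e.symm t), fun t => curveG (e.symm t), ?_⟩
  filter_upwards [e.open_source.mem_nhds hsource, isOpen_regularParameters.mem_nhds hr₀] with r hr hr'
  have hleft : e.symm (curveT r) = r := e.left_inv hr
  have hmem : curveT r ∈ V := ⟨e.map_source hr, by rw [Set.mem_preimage, hleft]; exact hr'⟩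
  have hD : ∀ (n : ℕ) (hn : n < 7), iteratedDeriv n (fun t => curveH (e.symm t)) (curveT r) =
      curveDeriv ⟨n, hn⟩ r := fun n hn => by rw [hiter n hn _ hmem, hleft]
  have hD1 : deriv (fun t => curveH (e.symm t)) (curveT r) = curveDeriv 1 r := by
    rw [← iteratedDeriv_one]
    exact hD 1 (by norm_num)
  refine ⟨by rw [hleft], hH _ hmem, hG _ hmem, ?_, ?_, fun u v _ h3 h4 => ?_⟩
  · rw [hD 2 (by norm_num)]
    obtain ⟨k0, k1, k2⟩ := hr'
    change (1 + 2 * r ^ 3) ^ 4 * (1 / 4) / (r ^ 3 * (1 - r ^ 3) ^ 3) ≠ 0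
    exact div_ne_zero (mul_ne_zero (pow_ne_zero _ k2) (by norm_num))
      (mul_ne_zero (pow_ne_zero _ k0) (pow_ne_zero _ k1))
  · simp only [NothAt]
    rw [hD 2 (by norm_num), hD 3 (by norm_num), hD 4 (by norm_num), hD 5 (by norm_num),
      hD 6 (by norm_num)]
    exact curveDeriv_noth hr'
  · simp only [omegaTwo, omegaThree, hD1, hleft] at h3 h4
    exact structuralTensor_eq_zero_of_curve hr' u v h3 h4

end NothCurve

end NothContact

/-! ### The main theorem -/

theorem mainTheorem3 (𝕜 : Type*) [RCLike 𝕜] :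
    NothContact.AssociatedToNothCurve 𝕜 ∧
    ∀ U : TopologicalSpace.Opens (NothContact.Coord 𝕜), IsConnected (U : Set (NothContact.Coord 𝕜)) →
      ∃ 𝔤 : LieSubalgebra 𝕜 (NothContact.smoothVF U),
        (∀ X : NothContact.smoothVF U,
          X ∈ 𝔤 ↔ NothContact.IsSymmetry U (X : NothContact.Coord 𝕜 → NothContact.Coord 𝕜)) ∧
        Nonempty (𝔤 ≃ₗ⁅𝕜⁆ LieAlgebra.g₂ 𝕜) ∧
        ∃ b : Module.Basis (Fin 12 ⊕ Fin 2) 𝕜 𝔤,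
          (∀ i, ∀ u ∈ U, (b i : NothContact.smoothVF U).1 u = NothContact.g2Field 𝕜 i u) ∧
          (∃ 𝔥 : LieSubalgebra 𝕜 𝔤, 𝔥.IsCartanSubalgebra ∧
            𝔥.toSubmodule = Submodule.span 𝕜 (Set.range fun j : Fin 2 => b (Sum.inr j))) ∧
          (∀ (j : Fin 2) (k : Fin 12), ⁅b (Sum.inr j), b (Sum.inl k)⁆ =
            NothContact.rootDiagram 𝕜 k j • b (Sum.inl k)) := by
  refine ⟨NothContact.associatedToNothCurve 𝕜, fun U hU => ?_⟩
  obtain ⟨𝔤, hmem, hiso, b, hb⟩ := NothContact.exists_symmetryAlgebra hU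
  have hroot : ∀ (j : Fin 2) (k : Fin 12), ⁅b (Sum.inr j), b (Sum.inl k)⁆ =
      NothContact.rootDiagram 𝕜 k j • b (Sum.inl k) := fun j k => Subtype.ext (by
    change ⁅(b (Sum.inr j)).1, (b (Sum.inl k)).1⁆ =
      NothContact.rootDiagram 𝕜 k j • (b (Sum.inl k)).1
    rw [hb, hb, NothContact.bracket_cartanVF_rootVF])
  have hcartan : ⁅b (Sum.inr 0), b (Sum.inr 1)⁆ = 0 := Subtype.ext (by
    rw [LieSubalgebra.coe_bracket, hb, hb, NothContact.bracket_cartanVF]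
    rfl)
  exact ⟨𝔤, hmem, hiso, b, fun i u hu => by rw [hb, NothContact.g2VF_apply i hu],
    NothContact.exists_isCartanSubalgebra b hcartan _ NothContact.rootDiagram_ne_zero hroot, hroot⟩
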